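/- Let $A=V/\Lambda$ be a complex abelian variety of dimension $8$. Let $\mathrm{Hod}(A)$ be its Hodge group, i.e. the smallest algebraic subgroup of $GL(H^1(A,\mathbf{Q}))$ defined over $\mathbf{Q}$ whose complex points contain $h(z)$ for all $z\in\mathbf{C}$ with $|z|=1$, where $h(z)$ acts on $H^{p,q}(A)\subset H^1(A,\mathbf{C})$ ($p+q=1$) as multiplication by $z^p\bar z^q$. Assume that $A$ is of $so(7)$-type in the following sense: the Lie algebra of $\mathrm{Hod}(A)(\mathbf{C})$ is $so(7)=so(7,\mathbf{C})$, and as a representation of it $H^1(A,\mathbf{C})\cong\Gamma\oplus\Gamma$, where $\Gamma$ is the $8$-dimensional spin representation of $so(7)$. For $p\geq 0$ let $B^p(A)=H^{2p}(A,\mathbf{Q})\cap H^{p,p}(A)$ be the $\mathbf{Q}$-vector space of Hodge classes of codimension $p$. Then $$\dim_{\mathbf{Q}} B^1(A)=1,\qquad \dim_{\mathbf{Q}} B^2(A)=6,\qquad \dim_{\mathbf{Q}}\bigl(\mathrm{End}(A)\otimes_{\mathbf{Z}}\mathbf{Q}\bigr)=4 .$$ -/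

import Mathlib

open scoped TensorProduct Topology

/-! ## The spin representation of `so(7)` -/

namespace Spin7

attribute [local instance 100] LieRing.ofAssociativeRing

/-- Index set of the basis `e₀; e₁, e₂, e₃; f₁, f₂, f₃` of `ℂ⁷`, on which the quadratic form is
`Q = x₀² + ∑ xᵢ yᵢ`; the Gram matrix of its polar form is `LieAlgebra.Orthogonal.JB (Fin 3) ℂ`. -/
abbrev Idx : Type := Unit ⊕ Fin 3 ⊕ Fin 3

/-- The complex Lie algebra `so(7)` of the quadratic form `Q`. -/
abbrev so7 : LieSubalgebra ℂ (Matrix Idx Idx ℂ) := LieAlgebra.Orthogonal.typeB (Fin 3) ℂ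

/-- The space of spinors `S = ⋀ R`, `R = ⟨e₁, e₂, e₃⟩`, with its basis `e_I`, `I ⊆ {1, 2, 3}`. -/
abbrev Spinor : Type := Finset (Fin 3) → ℂ

/-- Exterior multiplication by `eᵢ` on `⋀ R`, as an integral matrix in the basis `e_I`. -/
def wedge (i : Fin 3) : Matrix (Finset (Fin 3)) (Finset (Fin 3)) ℤ :=
  fun J I => if i ∉ I ∧ J = insert i I then (-1) ^ (I.filter (· < i)).card else 0

/-- Integral matrices of the Clifford action of the basis of `ℂ⁷` on `⋀ R`: `e₀` acts by the sign
`(-1)^|I|`, `eᵢ` by exterior multiplication, `fᵢ` by contraction. -/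
def gammaInt : Idx → Matrix (Finset (Fin 3)) (Finset (Fin 3)) ℤ
  | .inl _ => Matrix.diagonal fun I => (-1) ^ I.card
  | .inr (.inl i) => wedge i
  | .inr (.inr i) => (wedge i).transpose

/-- The Clifford action of the basis vectors of `ℂ⁷` on spinors. -/
def gamma (a : Idx) : Matrix (Finset (Fin 3)) (Finset (Fin 3)) ℂ :=
  (gammaInt a).map (Int.castRingHom ℂ)

/-- The inverse of the Gram matrix `JB` of the polar form of `Q`. -/
noncomputable def gramInv : Matrix Idx Idx ℂ :=
  Matrix.fromBlocks ((1 / 2 : ℂ) • 1) 0 0 (LieAlgebra.Orthogonal.JD (Fin 3) ℂ)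

/-- The image of a bivector `∑ T_{ab} v_a ⊗ v_b` in the endomorphisms of the spinors. -/
noncomputable def quadGamma :
    Matrix Idx Idx ℂ →ₗ[ℂ] Matrix (Finset (Fin 3)) (Finset (Fin 3)) ℂ where
  toFun T := ∑ a, ∑ b, T a b • (gamma a * gamma b)
  map_add' S T := by simp [add_smul, Finset.sum_add_distrib]
  map_smul' c T := by simp [Finset.smul_sum, smul_smul]

theorem gammaInt_rel : ∀ a b, gammaInt a * gammaInt b + gammaInt b * gammaInt a =
    LieAlgebra.Orthogonal.JB (Fin 3) ℤ a b • 1 := by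
  decide +kernel

theorem gamma_rel (a b : Idx) : gamma a * gamma b + gamma b * gamma a =
    LieAlgebra.Orthogonal.JB (Fin 3) ℂ a b • 1 := by
  have h := congrArg (fun M => M.map (Int.castRingHom ℂ)) (gammaInt_rel a b)
  have hJ : ((LieAlgebra.Orthogonal.JB (Fin 3) ℤ a b : ℤ) : ℂ) =
      LieAlgebra.Orthogonal.JB (Fin 3) ℂ a b := by
    rcases a with a | a | a <;> rcases b with b | b | b <;>
      simp [LieAlgebra.Orthogonal.JB, LieAlgebra.Orthogonal.JD, Matrix.one_apply, two_smul]
    norm_num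
  rw [← hJ]
  ext I J
  have h' := congrFun (congrFun h I) J
  simp only [Matrix.map_apply, Matrix.add_apply, map_add, Matrix.smul_apply, Matrix.mul_apply,
    map_sum, map_mul] at h'
  simp only [gamma, Matrix.add_apply, Matrix.mul_apply, Matrix.map_apply, h', Matrix.smul_apply]
  by_cases hIJ : I = J <;> simp [Matrix.one_apply, hIJ]

theorem gram_mul_gramInv : LieAlgebra.Orthogonal.JB (Fin 3) ℂ * gramInv = 1 := by
  simp [LieAlgebra.Orthogonal.JB, gramInv, LieAlgebra.Orthogonal.JD, Matrix.fromBlocks_multiply]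

theorem gramInv_mul_gram : gramInv * LieAlgebra.Orthogonal.JB (Fin 3) ℂ = 1 := by
  simp [LieAlgebra.Orthogonal.JB, gramInv, LieAlgebra.Orthogonal.JD, Matrix.fromBlocks_multiply]

theorem gramInv_transpose : gramInv.transpose = gramInv := by
  simp [gramInv, LieAlgebra.Orthogonal.JD, Matrix.fromBlocks_transpose]

theorem gram_transpose : (LieAlgebra.Orthogonal.JB (Fin 3) ℂ).transpose =
    LieAlgebra.Orthogonal.JB (Fin 3) ℂ := by
  simp [LieAlgebra.Orthogonal.JB, LieAlgebra.Orthogonal.JD, Matrix.fromBlocks_transpose]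

theorem gramInv_mul_transpose {X : Matrix Idx Idx ℂ} (hX : X ∈ so7) :
    gramInv * X.transpose = -(X * gramInv) := by
  have h : X.transpose * LieAlgebra.Orthogonal.JB (Fin 3) ℂ =
      LieAlgebra.Orthogonal.JB (Fin 3) ℂ * (-X) :=
    (mem_skewAdjointMatricesSubmodule _ _).1 hX
  calc gramInv * X.transpose
      = gramInv * (X.transpose * LieAlgebra.Orthogonal.JB (Fin 3) ℂ) * gramInv := by
        rw [Matrix.mul_assoc, Matrix.mul_assoc, gram_mul_gramInv, Matrix.mul_one]
    _ = -(X * gramInv) := by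
        rw [h, ← Matrix.mul_assoc, gramInv_mul_gram, Matrix.one_mul, Matrix.neg_mul]

theorem quadGamma_comm_gamma (T : Matrix Idx Idx ℂ) (c : Idx) :
    quadGamma T * gamma c - gamma c * quadGamma T =
      ∑ a, ((T - T.transpose) * LieAlgebra.Orthogonal.JB (Fin 3) ℂ) a c • gamma a := by
  have key : ∀ a b : Idx, gamma a * gamma b * gamma c - gamma c * (gamma a * gamma b) =
      LieAlgebra.Orthogonal.JB (Fin 3) ℂ b c • gamma a -
        LieAlgebra.Orthogonal.JB (Fin 3) ℂ a c • gamma b := by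
    intro a b
    have h1 := congrArg (fun M => gamma a * M) (gamma_rel b c)
    have h2 := congrArg (fun M => M * gamma b) (gamma_rel a c)
    simp only [mul_add, add_mul, Matrix.mul_smul, Matrix.smul_mul, Matrix.mul_one,
      Matrix.one_mul] at h1 h2
    rw [← h1, ← h2]
    noncomm_ring
  have h3 : quadGamma T * gamma c - gamma c * quadGamma T =
      ∑ a, ∑ b, T a b • (LieAlgebra.Orthogonal.JB (Fin 3) ℂ b c • gamma a -
        LieAlgebra.Orthogonal.JB (Fin 3) ℂ a c • gamma b) := by
    simp only [quadGamma, LinearMap.coe_mk, AddHom.coe_mk, Finset.sum_mul, Finset.mul_sum,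
      ← Finset.sum_sub_distrib, Matrix.smul_mul, Matrix.mul_smul, ← smul_sub, key]
  rw [h3]
  simp only [smul_sub, Finset.sum_sub_distrib, Matrix.sub_mul, Matrix.sub_apply, sub_smul,
    smul_smul]
  congr 1
  · simp only [Matrix.mul_apply, Finset.sum_smul]
  · rw [Finset.sum_comm]
    simp only [Matrix.mul_apply, Finset.sum_smul, Matrix.transpose_apply]

/-- The spin representation of `so(7)` on the `8`-dimensional space `S = ⋀ R`: the composite
`so(Q) ≅ ⋀² ℂ⁷ → Cl(Q) → End S`. -/
noncomputable def spinMatrix : so7 →ₗ⁅ℂ⁆ Matrix (Finset (Fin 3)) (Finset (Fin 3)) ℂ where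
  toFun X := (1 / 2 : ℂ) • quadGamma ((X : Matrix Idx Idx ℂ) * gramInv)
  map_add' X Y := by simp [Matrix.add_mul]
  map_smul' c X := by simp [smul_comm c]
  map_lie' := by
    intro X Y
    have hX := gramInv_mul_transpose X.2
    have hcomm : ∀ c, ⁅(1 / 2 : ℂ) • quadGamma ((X : Matrix Idx Idx ℂ) * gramInv), gamma c⁆ =
        ∑ a, (X : Matrix Idx Idx ℂ) a c • gamma a := by
      intro c
      rw [Ring.lie_def, Matrix.smul_mul, Matrix.mul_smul, ← smul_sub, quadGamma_comm_gamma,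
        Matrix.transpose_mul, gramInv_transpose, hX, sub_neg_eq_add, Matrix.add_mul,
        Matrix.mul_assoc, gramInv_mul_gram, Matrix.mul_one, Finset.smul_sum]
      refine Finset.sum_congr rfl fun a _ => ?_
      rw [Matrix.add_apply, smul_smul]
      congr 1
      ring
    generalize hA : (1 / 2 : ℂ) • quadGamma ((X : Matrix Idx Idx ℂ) * gramInv) = A at hcomm ⊢
    have hprod : ∀ a b, ⁅A, gamma a * gamma b⁆ =
        (∑ c, (X : Matrix Idx Idx ℂ) c a • gamma c) * gamma b +
          gamma a * ∑ c, (X : Matrix Idx Idx ℂ) c b • gamma c := by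
      intro a b
      rw [← hcomm, ← hcomm]
      simp only [Ring.lie_def]
      noncomm_ring
    have hquad : ∀ T : Matrix Idx Idx ℂ, ⁅A, quadGamma T⁆ =
        quadGamma ((X : Matrix Idx Idx ℂ) * T + T * (X : Matrix Idx Idx ℂ).transpose) := by
      intro T
      rw [map_add]
      have h1 : ⁅A, quadGamma T⁆ = ∑ a, ∑ b, T a b • ⁅A, gamma a * gamma b⁆ := by
        simp only [quadGamma, LinearMap.coe_mk, AddHom.coe_mk, lie_sum, lie_smul]
      rw [h1]
      simp only [hprod, smul_add, Finset.sum_add_distrib]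
      congr 1
      · simp only [quadGamma, LinearMap.coe_mk, AddHom.coe_mk, Matrix.mul_apply, Finset.sum_mul,
          Finset.smul_sum, Finset.sum_smul, Matrix.smul_mul, smul_smul]
        calc _ = ∑ a, ∑ c, ∑ b, (T a b * (X : Matrix Idx Idx ℂ) c a) • (gamma c * gamma b) :=
              Finset.sum_congr rfl fun a _ => Finset.sum_comm
          _ = ∑ c, ∑ a, ∑ b, (T a b * (X : Matrix Idx Idx ℂ) c a) • (gamma c * gamma b) :=
              Finset.sum_comm
          _ = _ := by
              refine Finset.sum_congr rfl fun c _ => ?_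
              rw [Finset.sum_comm]
              simp only [mul_comm]
      · simp only [quadGamma, LinearMap.coe_mk, AddHom.coe_mk, Matrix.mul_apply, Finset.mul_sum,
          Finset.smul_sum, Finset.sum_smul, Matrix.mul_smul, smul_smul, Matrix.transpose_apply]
        refine Finset.sum_congr rfl fun a _ => ?_
        rw [Finset.sum_comm]
    rw [lie_smul, hquad, Matrix.mul_assoc (Y : Matrix Idx Idx ℂ), hX]
    congr 2
    rw [LieSubalgebra.coe_bracket, Ring.lie_def]
    noncomm_ring

/-- The spin representation as endomorphisms of the space of spinors. -/
noncomputable def spin (X : so7) : Module.End ℂ Spinor := Matrix.toLin' (spinMatrix X)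

end Spin7

/-! ## Complex abelian varieties -/

/-- A complex abelian variety `A = V / Λ`: a lattice `Λ` in a finite-dimensional complex vector
space `V` such that the complex torus `V / Λ` admits a polarization (a Riemann form). -/
structure ComplexAbelianVariety (V : Type*) [NormedAddCommGroup V] [NormedSpace ℂ V]
    [FiniteDimensional ℂ V] where
  /-- the lattice `Λ = H₁(A, ℤ)` -/
  lattice : Submodule ℤ V
  discrete : DiscreteTopology lattice
  span_eq_top : Submodule.span ℝ (lattice : Set V) = ⊤
  polarizable : ∃ E : V →ₗ[ℝ] V →ₗ[ℝ] ℝ,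
    (∀ v, E v v = 0) ∧
    (∀ v ∈ lattice, ∀ w ∈ lattice, ∃ n : ℤ, E v w = n) ∧
    (∀ v w, E (Complex.I • v) (Complex.I • w) = E v w) ∧
    (∀ v, v ≠ 0 → 0 < E v (Complex.I • v))

namespace ComplexAbelianVariety

section Cohomology

variable (V : Type*) [NormedAddCommGroup V] [NormedSpace ℂ V]

/-- `H¹(A, ℂ) = Hom(Λ, ℂ)`, as the space of real-linear forms `V → ℂ`. -/
abbrev H1 : Type _ := V →ₗ[ℝ] ℂ

/-- `Hᵏ(A, ℂ) = ⋀ᵏ H¹(A, ℂ)`, as the space of alternating real-multilinear `k`-forms on `V`, that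
is, of translation invariant complex differential `k`-forms on the torus `A`. -/
abbrev H (k : ℕ) : Type _ := V [⋀^Fin k]→ₗ[ℝ] ℂ

/-- `H^{p,q}(A)`: the forms of type `(p, q)`, that is, those on which the homotheties `z ∈ ℂ` of
the tangent space `V` act through `z ^ p * conj z ^ q`. -/
noncomputable def hodgeType (p q : ℕ) : Submodule ℂ (H V (p + q)) where
  carrier := {ω | ∀ (z : ℂ) (v : Fin (p + q) → V),
    ω (fun i => z • v i) = z ^ p * (starRingEnd ℂ z) ^ q * ω v}
  zero_mem' := by simp
  add_mem' {a b} ha hb z v := by simp [ha z v, hb z v, mul_add]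
  smul_mem' c ω h z v := by simp [h z v, mul_left_comm]

/-- `h(z)` for `z ∈ ℂ` of absolute value `1`, acting on `H¹(A, ℂ)` by pull-back along the
homothety `z` of `V`; it is multiplication by `z ^ p * conj z ^ q` on `H^{p,q}(A)`, `p + q = 1`. -/
noncomputable def hodgeCircleHom : Circle →* Module.End ℂ (H1 V) where
  toFun z :=
    { toFun := fun ω => ω ∘ₗ (DistribSMul.toLinearMap ℝ V (z : ℂ))
      map_add' := fun _ _ => rfl
      map_smul' := fun _ _ => rfl }
  map_one' := by ext ω v; simp
  map_mul' z w := by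
    ext ω v
    simp [mul_smul, smul_comm (z : ℂ)]

/-- The homomorphism `h : S¹ → GL(H¹(A, ℂ))` that gives the Hodge structure. -/
noncomputable def hodgeCircle : Circle →* (Module.End ℂ (H1 V))ˣ :=
  (hodgeCircleHom V).toHomUnits

end Cohomology

variable {V : Type*} [NormedAddCommGroup V] [NormedSpace ℂ V] [FiniteDimensional ℂ V]
  (A : ComplexAbelianVariety V)

/-- `H¹(A, ℚ) ⊆ H¹(A, ℂ)`: the forms with rational values on `Λ = H₁(A, ℤ)`. -/
noncomputable def H1Rat : Submodule ℚ (H1 V) where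
  carrier := {ω | ∀ v ∈ A.lattice, ∃ r : ℚ, ω v = r}
  zero_mem' v _ := ⟨0, by simp⟩
  add_mem' {a b} ha hb v hv := by
    obtain ⟨r, hr⟩ := ha v hv
    obtain ⟨s, hs⟩ := hb v hv
    exact ⟨r + s, by simp [hr, hs]⟩
  smul_mem' c ω h v hv := by
    obtain ⟨r, hr⟩ := h v hv
    exact ⟨c * r, by simp [hr, Rat.smul_def]⟩

/-- `Hᵏ(A, ℚ) ⊆ Hᵏ(A, ℂ)`: the forms with rational values on `Λ = H₁(A, ℤ)`. -/
noncomputable def HRat (k : ℕ) : Submodule ℚ (H V k) where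
  carrier := {ω | ∀ v : Fin k → V, (∀ i, v i ∈ A.lattice) → ∃ r : ℚ, ω v = r}
  zero_mem' v _ := ⟨0, by simp⟩
  add_mem' {a b} ha hb v hv := by
    obtain ⟨r, hr⟩ := ha v hv
    obtain ⟨s, hs⟩ := hb v hv
    exact ⟨r + s, by simp [hr, hs]⟩
  smul_mem' c ω h v hv := by
    obtain ⟨r, hr⟩ := h v hv
    exact ⟨c * r, by simp [hr, Rat.smul_def]⟩

/-- The space of Hodge classes `Bᵖ(A) = H^{2p}(A, ℚ) ∩ H^{p,p}(A)`. -/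
noncomputable def hodgeClasses (p : ℕ) : Submodule ℚ (H V (p + p)) :=
  A.HRat (p + p) ⊓ (hodgeType V p p).restrictScalars ℚ

/-! ### The Hodge group and its Lie algebra -/

/-- The polynomial functions with rational coefficients on `End(H¹(A, ℂ)) = End(H¹(A, ℚ)) ⊗ ℂ`:
they are generated by the matrix coefficients `g ↦ ⟨g ω, v⟩` with `ω ∈ H¹(A, ℚ)` and
`v ∈ Λ = H₁(A, ℤ)`. -/
noncomputable def ratPolynomials : Subalgebra ℚ (Module.End ℂ (H1 V) → ℂ) :=
  Algebra.adjoin ℚ {F | ∃ ω ∈ A.H1Rat, ∃ v ∈ A.lattice, F = fun g => g ω v}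

/-- `G` is (the group of complex points of) an algebraic subgroup of `GL(H¹(A, ℚ))`, defined
over `ℚ`. -/
def IsAlgebraicOverRat (G : Subgroup (Module.End ℂ (H1 V))ˣ) : Prop :=
  ∃ S ⊆ (A.ratPolynomials : Set (Module.End ℂ (H1 V) → ℂ)),
    ∀ g, g ∈ G ↔ ∀ F ∈ S, F (g : Module.End ℂ (H1 V)) = 0

/-- The complex points `Hod(A)(ℂ)` of the Hodge group: the smallest algebraic subgroup of
`GL(H¹(A, ℚ))` defined over `ℚ` that contains `h(S¹)`. -/
noncomputable def hodgeGroup : Subgroup (Module.End ℂ (H1 V))ˣ :=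
  sInf {G | A.IsAlgebraicOverRat G ∧ ∀ z, hodgeCircle V z ∈ G}

/-- The Lie algebra of `Hod(A)(ℂ)`, as a subset of `End(H¹(A, ℂ))`: the tangent space at the
identity, cut out by the differentials of the rational polynomials that vanish on `Hod(A)`. -/
noncomputable def hodgeLie : Set (Module.End ℂ (H1 V)) :=
  {X | ∀ F ∈ A.ratPolynomials, (∀ g ∈ A.hodgeGroup, F (g : Module.End ℂ (H1 V)) = 0) →
    lineDeriv ℂ F 1 X = 0}

/-- `A` is an abelian `8`-fold of `so(7)`-type: the Lie algebra of `Hod(A)(ℂ)` is `so(7)`, and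
`H¹(A, ℂ)` is the sum of two copies of the spin representation of `so(7)`. -/
def IsSo7Type : Prop :=
  Module.finrank ℂ V = 8 ∧
    ∃ e : H1 V ≃ₗ[ℂ] Spin7.Spinor × Spin7.Spinor,
      A.hodgeLie = {X | ∃ x : Spin7.so7, ∀ ω,
        e (X ω) = (Spin7.spin x (e ω).1, Spin7.spin x (e ω).2)}

/-! ### Endomorphisms -/

/-- A map `A → A` is holomorphic if locally it lifts to holomorphic maps on `V`. -/
def IsHolomorphic (φ : V ⧸ A.lattice → V ⧸ A.lattice) : Prop :=
  ∀ v : V, ∃ f : V → V, ∀ᶠ w in 𝓝 v, DifferentiableAt ℂ f w ∧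
    A.lattice.mkQ (f w) = φ (A.lattice.mkQ w)

/-- The ring `End(A)` of holomorphic group endomorphisms of `A = V / Λ`. -/
noncomputable def endRing : Subring (AddMonoid.End (V ⧸ A.lattice)) where
  carrier := {φ | A.IsHolomorphic φ}
  zero_mem' v := ⟨fun _ => 0, .of_forall fun w => ⟨differentiableAt_const _, by simp⟩⟩
  one_mem' v := ⟨id, .of_forall fun w => ⟨differentiableAt_id, rfl⟩⟩
  add_mem' {φ ψ} hφ hψ v := by
    obtain ⟨f, hf⟩ := hφ v
    obtain ⟨g, hg⟩ := hψ v
    refine ⟨fun w => f w + g w, ?_⟩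
    filter_upwards [hf, hg] with w hfw hgw
    exact ⟨hfw.1.add hgw.1, by rw [map_add, hfw.2, hgw.2]; rfl⟩
  neg_mem' {φ} hφ v := by
    obtain ⟨f, hf⟩ := hφ v
    refine ⟨fun w => -f w, ?_⟩
    filter_upwards [hf] with w hfw
    exact ⟨hfw.1.neg, by rw [map_neg, hfw.2]; rfl⟩
  mul_mem' {φ ψ} hφ hψ v := by
    obtain ⟨g, hg⟩ := hψ v
    obtain ⟨f, hf⟩ := hφ (g v)
    refine ⟨fun w => f (g w), ?_⟩
    filter_upwards [hg, hg.self_of_nhds.1.continuousAt.eventually hf] with w hgw hfw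
    exact ⟨hfw.1.comp w hgw.1, by rw [hfw.2, hgw.2]; rfl⟩

end ComplexAbelianVariety

open scoped symmDiff

/-!
`Hod(A)` is generated by the circle `h`, and its Lie algebra is defined over `ℚ`. A rational tensor
is therefore a Hodge class iff it is killed by that Lie algebra, and the tensors so killed have a
rational basis. This turns `dim_ℚ B^p(A)` into the dimension of the `so(7)`-invariant alternating
`2p`-forms on `Γ ⊕ Γ`, and `dim_ℚ End(A) ⊗ ℚ` into that of the commutant of `so(7)` in
`End(Γ ⊕ Γ)`, which by Schur's lemma is `M₂(ℂ)`.

On spinors, `so(7)` is spanned by `21` of the `64` Pauli matrices. The commutator with one of them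
sends each Pauli matrix to a multiple of another. The connected pieces of this action are the
four summands `⋀⁰, ⋀¹, ⋀², ⋀³` of `End Γ ≅ Γ ⊗ Γ`, and comparing coefficients along it shows that
`Γ^{⊗2}` has one invariant, a symmetric form `g`, and that `Γ^{⊗4}` has at most four. The three
products of two copies of `g` and an alternating form `Ω`, the Cayley form, are four independent
ones.

On `Γ ⊕ Γ = Γ ⊗ ℂ²`, the invariant alternating `2`-forms are thus the multiples of `g ⊗ ε` with `ε`
the area form of `ℂ²`. In degree four, `Ω ⊗ s` with `s` in the `5`-dimensional space of symmetric
`4`-tensors of `ℂ²` and the square of `g ⊗ ε` give `6 = 5 + 1`.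
-/

/-! ## Pauli matrices -/

namespace Spin7

section Pauli

variable {α : Type*} [DecidableEq α]

/-- The pairing `(-1) ^ |s ∩ t|` of the elementary abelian `2`-group of finite subsets of `α`, with
symmetric difference as addition, with itself. -/
def character (s t : Finset α) : ℤ := (-1) ^ (s ∩ t).card

theorem character_eq_prod (s t : Finset α) :
    character s t = ∏ i ∈ t, if i ∈ s then -1 else 1 := by
  rw [character, Finset.prod_ite, Finset.prod_const_one, mul_one, Finset.prod_const,
    Finset.filter_mem_eq_inter, Finset.inter_comm]

theorem character_comm (s t : Finset α) : character s t = character t s := by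
  rw [character, character, Finset.inter_comm]

theorem character_symmDiff_left (s s' t : Finset α) :
    character (s ∆ s') t = character s t * character s' t := by
  simp only [character_eq_prod, ← Finset.prod_mul_distrib, Finset.mem_symmDiff]
  refine Finset.prod_congr rfl fun i _ => ?_
  by_cases i ∈ s <;> by_cases i ∈ s' <;> simp_all

theorem character_symmDiff_right (s t t' : Finset α) :
    character s (t ∆ t') = character s t * character s t' := by
  simp only [character_comm s, character_symmDiff_left]

@[simp]
theorem character_mul_self (s t : Finset α) : character s t * character s t = 1 := by
  rw [character, ← mul_pow, neg_one_mul, neg_neg, one_pow]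

theorem sum_character [Fintype α] (s : Finset α) :
    ∑ t, character s t = if s = ∅ then 2 ^ Fintype.card α else 0 := by
  simp only [character_eq_prod]
  rw [← Finset.powerset_univ, ← Finset.prod_one_add]
  split_ifs with hs
  · simp [hs, one_add_one_eq_two]
  · obtain ⟨i, hi⟩ := Finset.nonempty_iff_ne_empty.2 hs
    exact Finset.prod_eq_zero (Finset.mem_univ i) (by simp [hi])

/-- The sign in the product of two Pauli matrices. -/
def pauliSign (u v : Finset α × Finset α) : ℤ := character v.1 u.2

@[simp]
theorem pauliSign_mul_self (u v : Finset α × Finset α) : pauliSign u v * pauliSign u v = 1 :=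
  character_mul_self _ _

theorem pauliSign_ne_zero (u v : Finset α × Finset α) : pauliSign u v ≠ 0 :=
  left_ne_zero_of_mul_eq_one (pauliSign_mul_self u v)

theorem pauliSign_symmDiff_right (u v w : Finset α × Finset α) :
    pauliSign u (v ∆ w) = pauliSign u v * pauliSign u w :=
  character_symmDiff_left _ _ _

theorem pauliSign_symmDiff_left (u v w : Finset α × Finset α) :
    pauliSign (u ∆ v) w = pauliSign u w * pauliSign v w :=
  character_symmDiff_right _ _ _

variable (R : Type*) [CommRing R]

/-- The Pauli matrix `e_I ↦ (-1) ^ |I ∩ b| e_{I ∆ a}` with label `(a, b)`. Up to sign the Pauli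
matrices form a group, whose quotient by the signs is the group of labels under `∆`. -/
def pauli (u : Finset α × Finset α) : Matrix (Finset α) (Finset α) R :=
  fun J I => if J = I ∆ u.1 then (character I u.2 : R) else 0

@[simp]
theorem pauli_bot : pauli R (⊥ : Finset α × Finset α) = 1 := by
  ext J I
  have h : I ∆ ∅ = I := symmDiff_bot I
  simp [pauli, character, Matrix.one_apply, h]

theorem pauli_transpose (u : Finset α × Finset α) :
    (pauli R u).transpose = (pauliSign u u : R) • pauli R u := by
  ext J I
  have h : I = J ∆ u.1 ↔ J = I ∆ u.1 := by
    constructor <;> rintro rfl <;> rw [symmDiff_symmDiff_cancel_right]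
  simp only [Matrix.transpose_apply, Matrix.smul_apply, pauli, pauliSign, smul_eq_mul, h]
  split_ifs with hJ
  · rw [hJ, character_symmDiff_left]; push_cast; ring
  · rw [mul_zero]

theorem pauli_map {S : Type*} [CommRing S] (f : R →+* S) (u : Finset α × Finset α) :
    (pauli R u).map f = pauli S u := by
  ext J I
  simp only [Matrix.map_apply, pauli, apply_ite f, map_intCast, map_zero]

theorem pauli_eq_intCast (R : Type*) [CommRing R] (u : Finset α × Finset α) (I J : Finset α) :
    pauli R u I J = (pauli ℤ u I J : ℤ) :=
  (congrFun₂ (pauli_map ℤ (Int.castRingHom R) u) I J).symm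

variable [Fintype α]

theorem pauli_mul (u v : Finset α × Finset α) :
    pauli R u * pauli R v = (pauliSign u v : R) • pauli R (u ∆ v) := by
  ext J I
  rw [Matrix.mul_apply, Finset.sum_eq_single (I ∆ v.1)]
  · have h : (I ∆ v.1) ∆ u.1 = I ∆ (u ∆ v).1 := by
      rw [symmDiff_assoc, symmDiff_comm v.1]; rfl
    have h' : character I (u ∆ v).2 = character I u.2 * character I v.2 :=
      character_symmDiff_right _ _ _
    simp only [pauli, h, h', Matrix.smul_apply, pauliSign, if_true, character_symmDiff_left,
      smul_eq_mul]
    split_ifs <;> push_cast <;> ring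
  · intro K _ hK
    simp [pauli, hK]
  · simp

theorem pauli_mul_transpose (u v : Finset α × Finset α) :
    pauli R v * (pauli R u).transpose = (pauliSign u u * pauliSign v u : R) • pauli R (u ∆ v) := by
  rw [pauli_transpose, Matrix.mul_smul, pauli_mul, smul_smul, symmDiff_comm]

theorem two_pow_smul_single (J I : Finset α) :
    (2 ^ Fintype.card α : R) • Matrix.single J I (1 : R) =
      ∑ c, (character I c : R) • pauli R (I ∆ J, c) := by
  ext J' I'
  have hsum : ∑ c, character I c * character I' c = if I = I' then 2 ^ Fintype.card α else 0 := by
    simp only [← character_symmDiff_left, sum_character, ← Finset.bot_eq_empty, symmDiff_eq_bot]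
  have hsumR := congrArg (Int.cast : ℤ → R) hsum
  push_cast at hsumR
  simp only [Matrix.sum_apply, Matrix.smul_apply, pauli, smul_eq_mul, mul_ite, mul_zero]
  by_cases hJ : J' = I' ∆ (I ∆ J)
  · simp only [hJ, if_true, hsumR]
    by_cases hI : I = I'
    · simp [hI, symmDiff_symmDiff_cancel_left]
    · simp [hI]
  · have : ¬(J = J' ∧ I = I') := by
      rintro ⟨rfl, rfl⟩; exact hJ (symmDiff_symmDiff_cancel_left _ _).symm
    simp [hJ, this]

end Pauli

section Span

variable (α K : Type*) [DecidableEq α] [Finite α] [Field K] [NeZero (2 : K)]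

theorem span_range_pauli :
    Submodule.span K (Set.range (pauli K : Finset α × Finset α → _)) = ⊤ := by
  have := Fintype.ofFinite α
  rw [eq_top_iff, ← (Matrix.stdBasis K (Finset α) (Finset α)).span_eq, Submodule.span_le]
  rintro _ ⟨⟨J, I⟩, rfl⟩
  rw [Matrix.stdBasis_eq_single]
  refine (Submodule.smul_mem_iff _ (pow_ne_zero (Fintype.card α) (two_ne_zero (α := K)))).1 ?_
  rw [two_pow_smul_single]
  exact Submodule.sum_mem _ fun c _ => Submodule.smul_mem _ _ (Submodule.subset_span ⟨_, rfl⟩)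

end Span

end Spin7

namespace Spin7

section LieCoeff

variable {α : Type*} [DecidableEq α]

/-- The structure constant of the commutator of two Pauli matrices. -/
def lieCoeff (u v : Finset α × Finset α) : ℤ := pauliSign u v - pauliSign v u

theorem lieCoeff_symmDiff_self (u v : Finset α × Finset α) :
    lieCoeff u (u ∆ v) = pauliSign u u * lieCoeff u v := by
  rw [lieCoeff, lieCoeff, pauliSign_symmDiff_right, pauliSign_symmDiff_left, mul_sub]

theorem lieCoeff_symmDiff_eq_zero {u v w : Finset α × Finset α} (hv : lieCoeff u v = 0)
    (hw : lieCoeff u w = 0) : lieCoeff u (v ∆ w) = 0 := by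
  rw [lieCoeff, sub_eq_zero] at *
  rw [pauliSign_symmDiff_left, pauliSign_symmDiff_right, hv, hw]

theorem pauliSign_swap_of_lieCoeff_ne_zero {u v : Finset α × Finset α} (h : lieCoeff u v ≠ 0) :
    pauliSign v u = -pauliSign u v := by
  have hsq : pauliSign u v ^ 2 = pauliSign v u ^ 2 := by
    rw [sq, sq, pauliSign_mul_self, pauliSign_mul_self]
  rcases sq_eq_sq_iff_eq_or_eq_neg.1 hsq with h' | h'
  · exact absurd (sub_eq_zero.2 h') h
  · rw [h', neg_neg]

theorem lieCoeff_symmDiff_eq_zero_of_ne_zero {u v w : Finset α × Finset α}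
    (hv : lieCoeff u v ≠ 0) (hw : lieCoeff u w ≠ 0) : lieCoeff u (v ∆ w) = 0 := by
  rw [lieCoeff, sub_eq_zero, pauliSign_symmDiff_left, pauliSign_symmDiff_right,
    pauliSign_swap_of_lieCoeff_ne_zero hv, pauliSign_swap_of_lieCoeff_ne_zero hw, neg_mul_neg]

theorem pauli_mul_sub_mul [Fintype α] (R : Type*) [CommRing R] (u v : Finset α × Finset α) :
    pauli R u * pauli R v - pauli R v * pauli R u = (lieCoeff u v : R) • pauli R (u ∆ v) := by
  rw [pauli_mul, pauli_mul, symmDiff_comm v, ← sub_smul, lieCoeff, Int.cast_sub]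

end LieCoeff

/-! ## The image of `so(7)` -/

/-- Labels of the Pauli matrices. -/
abbrev Label : Type := Finset (Fin 3) × Finset (Fin 3)

/-- Labels of seven pairwise anticommuting Pauli matrices, which span the same space as the
Clifford matrices `γ_a`. -/
def gen : Fin 7 → Label :=
  ![({0}, ∅), ({1}, {0}), ({2}, {0, 1}), ({0}, {0}), ({1}, {0, 1}), ({2}, {0, 1, 2}),
    (∅, {0, 1, 2})]

/-- Labels of the Pauli matrices that span the image of `so(7)`. -/
def roots : Finset Label :=
  (Finset.univ.filter fun p : Fin 7 × Fin 7 => p.1 < p.2).image fun p => gen p.1 ∆ gen p.2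

theorem mem_roots {r : Label} : r ∈ roots ↔ ∃ i j, i < j ∧ gen i ∆ gen j = r := by
  simp [roots]

theorem gen_symmDiff_gen_mem_roots {i j : Fin 7} (hij : i ≠ j) : gen i ∆ gen j ∈ roots := by
  rcases hij.lt_or_gt with h | h
  · exact mem_roots.2 ⟨i, j, h, rfl⟩
  · exact mem_roots.2 ⟨j, i, h, symmDiff_comm _ _⟩

theorem pauliSign_gen_swap :
    ∀ i j, i ≠ j → pauliSign (gen j) (gen i) = -pauliSign (gen i) (gen j) := by
  decide +kernel

theorem lieCoeff_gen_ne_zero {i j : Fin 7} (hij : i ≠ j) : lieCoeff (gen i) (gen j) ≠ 0 := by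
  rw [lieCoeff, pauliSign_gen_swap i j hij, sub_neg_eq_add, ← two_mul]
  exact mul_ne_zero two_ne_zero (pauliSign_ne_zero _ _)

/-- The coordinates of the Pauli generators with respect to the Clifford matrices `γ_a`: the sums
`eₖ + fₖ`, the differences `eₖ - fₖ`, and `e₀`. -/
def genCoeff : Fin 7 → Idx → ℤ
  | 0, .inr (.inl 0) => 1
  | 0, .inr (.inr 0) => 1
  | 1, .inr (.inl 1) => 1
  | 1, .inr (.inr 1) => 1
  | 2, .inr (.inl 2) => 1
  | 2, .inr (.inr 2) => 1
  | 3, .inr (.inl 0) => 1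
  | 3, .inr (.inr 0) => -1
  | 4, .inr (.inl 1) => 1
  | 4, .inr (.inr 1) => -1
  | 5, .inr (.inl 2) => 1
  | 5, .inr (.inr 2) => -1
  | 6, .inl _ => 1
  | _, _ => 0

theorem pauli_int_gen : ∀ i, pauli ℤ (gen i) = ∑ a, genCoeff i a • gammaInt a := by
  decide +kernel

theorem two_smul_gammaInt : ∀ a, (2 : ℤ) • gammaInt a =
    ∑ i, ((if a = .inl () then 2 else 1) * genCoeff i a) • pauli ℤ (gen i) := by
  decide +kernel

theorem map_intCast_smul {n R : Type*} [Ring R] (c : ℤ) (M : Matrix n n ℤ) :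
    (c • M).map (Int.castRingHom R) = (c : R) • M.map (Int.castRingHom R) := by
  ext
  simp

theorem map_intCast_sum_smul {n ι R : Type*} [Ring R] [Fintype ι] (c : ι → ℤ)
    (M : ι → Matrix n n ℤ) :
    (∑ i, c i • M i).map (Int.castRingHom R) =
      ∑ i, (c i : R) • (M i).map (Int.castRingHom R) := by
  ext
  simp [Matrix.sum_apply]

theorem pauli_gen (i : Fin 7) : pauli ℂ (gen i) = ∑ a, (genCoeff i a : ℂ) • gamma a := by
  rw [← pauli_map ℤ (Int.castRingHom ℂ), pauli_int_gen, map_intCast_sum_smul]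
  rfl

theorem two_smul_gamma (a : Idx) : (2 : ℂ) • gamma a =
    ∑ i, (((if a = .inl () then 2 else 1) * genCoeff i a : ℤ) : ℂ) • pauli ℂ (gen i) := by
  have h := congrArg (fun M => M.map (Int.castRingHom ℂ)) (two_smul_gammaInt a)
  simpa only [map_intCast_sum_smul, map_intCast_smul, pauli_map, Int.cast_ofNat] using! h

theorem span_range_gamma :
    Submodule.span ℂ (Set.range gamma) = Submodule.span ℂ (Set.range fun i => pauli ℂ (gen i)) := by
  refine le_antisymm (Submodule.span_le.2 ?_) (Submodule.span_le.2 ?_)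
  · rintro _ ⟨a, rfl⟩
    refine (Submodule.smul_mem_iff _ (two_ne_zero (α := ℂ))).1 ?_
    rw [two_smul_gamma]
    exact Submodule.sum_mem _ fun i _ => Submodule.smul_mem _ _ (Submodule.subset_span ⟨i, rfl⟩)
  · rintro _ ⟨i, rfl⟩
    change pauli ℂ (gen i) ∈ _
    rw [pauli_gen]
    exact Submodule.sum_mem _ fun a _ => Submodule.smul_mem _ _ (Submodule.subset_span ⟨a, rfl⟩)

theorem quadGamma_single (a b : Idx) : quadGamma (Matrix.single a b 1) = gamma a * gamma b := by
  simp [quadGamma, Matrix.single_apply, ite_and, -Fintype.sum_sum_type]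

theorem quadGamma_transpose (T : Matrix Idx Idx ℂ) :
    quadGamma T.transpose = ∑ a, ∑ b, T a b • (gamma b * gamma a) := by
  simp only [quadGamma, LinearMap.coe_mk, AddHom.coe_mk, Matrix.transpose_apply]
  exact Finset.sum_comm

theorem exists_spinMatrix_eq_commutator (a b : Idx) :
    ∃ x : so7, spinMatrix x = (1 / 2 : ℂ) • (gamma a * gamma b - gamma b * gamma a) := by
  set T : Matrix Idx Idx ℂ := Matrix.single a b 1 - Matrix.single b a 1 with hT
  have hTt : T.transpose = -T := by simp [hT]
  have hmem : T * LieAlgebra.Orthogonal.JB (Fin 3) ℂ ∈ so7 := by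
    refine (mem_skewAdjointMatricesSubmodule _ _).2 ?_
    change (T * LieAlgebra.Orthogonal.JB (Fin 3) ℂ).transpose *
      LieAlgebra.Orthogonal.JB (Fin 3) ℂ =
        LieAlgebra.Orthogonal.JB (Fin 3) ℂ * -(T * LieAlgebra.Orthogonal.JB (Fin 3) ℂ)
    rw [Matrix.transpose_mul, gram_transpose, hTt]
    noncomm_ring
  refine ⟨⟨_, hmem⟩, ?_⟩
  change (1 / 2 : ℂ) • quadGamma (T * LieAlgebra.Orthogonal.JB (Fin 3) ℂ * gramInv) = _
  rw [Matrix.mul_assoc, gram_mul_gramInv, Matrix.mul_one, hT, map_sub, quadGamma_single,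
    quadGamma_single]

theorem spinMatrix_eq_sum_commutator (x : so7) :
    spinMatrix x = ∑ a, ∑ b, ((1 / 4 : ℂ) * ((x : Matrix Idx Idx ℂ) * gramInv) a b) •
      (gamma a * gamma b - gamma b * gamma a) := by
  set T := (x : Matrix Idx Idx ℂ) * gramInv with hT
  have hskew : T.transpose = -T := by
    rw [hT, Matrix.transpose_mul, gramInv_transpose, gramInv_mul_transpose x.2]
  have hflip : -quadGamma T = ∑ a, ∑ b, T a b • (gamma b * gamma a) := by
    rw [← quadGamma_transpose, hskew, map_neg]
  calc spinMatrix x = (1 / 4 : ℂ) • (quadGamma T - -quadGamma T) := by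
        change (1 / 2 : ℂ) • quadGamma T = _
        module
    _ = (1 / 4 : ℂ) • ∑ a, ∑ b, T a b • (gamma a * gamma b - gamma b * gamma a) := by
        rw [hflip]
        simp only [quadGamma, LinearMap.coe_mk, AddHom.coe_mk, smul_sub,
          Finset.sum_sub_distrib]
    _ = _ := by simp only [Finset.smul_sum, smul_smul]

/-- The commutator in an associative algebra as a bilinear map. -/
noncomputable def commutator (R M : Type*) [CommRing R] [Ring M] [Algebra R M] :
    M →ₗ[R] M →ₗ[R] M :=
  LinearMap.mul R M - (LinearMap.mul R M).flip

theorem range_spinMatrix_eq_map₂ : LinearMap.range (spinMatrix : so7 →ₗ[ℂ] _) =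
    Submodule.map₂ (commutator ℂ _) (Submodule.span ℂ (Set.range gamma))
      (Submodule.span ℂ (Set.range gamma)) := by
  rw [Submodule.map₂_span_span]
  refine le_antisymm ?_ (Submodule.span_le.2 ?_)
  · rintro _ ⟨x, rfl⟩
    change spinMatrix x ∈ _
    rw [spinMatrix_eq_sum_commutator]
    exact Submodule.sum_mem _ fun a _ => Submodule.sum_mem _ fun b _ =>
      Submodule.smul_mem _ _ (Submodule.subset_span ⟨_, ⟨a, rfl⟩, _, ⟨b, rfl⟩, rfl⟩)
  · rintro _ ⟨_, ⟨a, rfl⟩, _, ⟨b, rfl⟩, rfl⟩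
    obtain ⟨x, hx⟩ := exists_spinMatrix_eq_commutator a b
    exact (Submodule.smul_mem_iff _ (one_div_ne_zero two_ne_zero)).1 ⟨x, hx⟩

theorem range_spinMatrix : LinearMap.range (spinMatrix : so7 →ₗ[ℂ] _) =
    Submodule.span ℂ (pauli ℂ '' (roots : Set Label)) := by
  rw [range_spinMatrix_eq_map₂, span_range_gamma, Submodule.map₂_span_span]
  have hlie : ∀ i j, commutator ℂ _ (pauli ℂ (gen i)) (pauli ℂ (gen j)) =
      (lieCoeff (gen i) (gen j) : ℂ) • pauli ℂ (gen i ∆ gen j) := fun i j =>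
    pauli_mul_sub_mul ℂ _ _
  refine le_antisymm (Submodule.span_le.2 ?_) (Submodule.span_le.2 ?_)
  · rintro _ ⟨_, ⟨i, rfl⟩, _, ⟨j, rfl⟩, rfl⟩
    change commutator ℂ _ (pauli ℂ (gen i)) (pauli ℂ (gen j)) ∈ _
    rw [hlie]
    rcases eq_or_ne i j with rfl | hij
    · simp [lieCoeff]
    · exact Submodule.smul_mem _ _ (Submodule.subset_span ⟨_, gen_symmDiff_gen_mem_roots hij, rfl⟩)
  · rintro _ ⟨r, hr, rfl⟩
    obtain ⟨i, j, hij, rfl⟩ := mem_roots.1 hr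
    rw [SetLike.mem_coe, ← Submodule.smul_mem_iff _
      (Int.cast_ne_zero.2 (lieCoeff_gen_ne_zero hij.ne) : (_ : ℂ) ≠ 0), ← hlie]
    exact Submodule.subset_span ⟨_, ⟨i, rfl⟩, _, ⟨j, rfl⟩, rfl⟩

end Spin7

namespace Spin7

/-! ## Orbits of labels -/

theorem exists_lieCoeff_ne_zero : ∀ u : Label, u ≠ ⊥ → ∃ r ∈ roots, lieCoeff r u ≠ 0 := by
  decide +kernel

theorem exists_lieCoeff_separating {u v : Label} (huv : u ≠ v) : ∃ r ∈ roots,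
    (lieCoeff r u ≠ 0 ∧ lieCoeff r v = 0) ∨ (lieCoeff r u = 0 ∧ lieCoeff r v ≠ 0) := by
  obtain ⟨r, hr, h⟩ := exists_lieCoeff_ne_zero (u ∆ v) (symmDiff_eq_bot.not.2 huv)
  refine ⟨r, hr, ?_⟩
  contrapose! h
  by_cases hu : lieCoeff r u = 0
  · exact lieCoeff_symmDiff_eq_zero hu (h.2 hu)
  · exact lieCoeff_symmDiff_eq_zero_of_ne_zero hu (h.1 hu)

/-- Labels of the products of at most three Pauli generators: representatives for the linkage
relation of labels that is generated by `u ∼ r ∆ u` for roots `r` with `lieCoeff r u ≠ 0`. -/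
def orbitRep : Fin 4 → Label := ![⊥, gen 0, gen 0 ∆ gen 1, gen 0 ∆ gen 1 ∆ gen 2]

/-- Whether `u` is linked to a representative by at most `n` roots. -/
def linked : ℕ → Label → Bool
  | 0, u => ∃ k, u = orbitRep k
  | n + 1, u => linked n u ∨ ∃ r ∈ roots, lieCoeff r u ≠ 0 ∧ linked n (r ∆ u)

theorem linked_three : ∀ u, linked 3 u := by
  decide +kernel

theorem label_induction {p : Label → Prop} (rep : ∀ k, p (orbitRep k))
    (step : ∀ r ∈ roots, ∀ u, lieCoeff r u ≠ 0 → p (r ∆ u) → p u) (u : Label) : p u := by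
  suffices ∀ n u, linked n u → p u from this 3 u (linked_three u)
  intro n
  induction n with
  | zero =>
    intro u hu
    obtain ⟨k, rfl⟩ := of_decide_eq_true hu
    exact rep k
  | succ n ih =>
    intro u hu
    obtain hu | ⟨r, hr, hru, hu⟩ := of_decide_eq_true hu
    · exact ih u hu
    · exact step r hr u hru (ih _ hu)

/-- The label of the invariant symmetric bilinear form on spinors. -/
def formLabel : Label := (Finset.univ, {0, 2})

theorem lieCoeff_form : ∀ r ∈ roots,
    pauliSign r formLabel + pauliSign r r * pauliSign formLabel r = 0 := by
  decide +kernel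

end Spin7

/-! ## Tensors in coordinates -/

/-- The coordinates of tensors of order `k` with respect to a basis indexed by `ι`. -/
abbrev CoordTensor (R ι : Type*) (k : ℕ) : Type _ := (Fin k → ι) → R

namespace CoordTensor

open Function

variable {R ι : Type*} [CommRing R] {k : ℕ}

/-- The action of a permutation on tensors through the positions of the factors. -/
def perm (σ : Equiv.Perm (Fin k)) : CoordTensor R ι k →ₗ[R] CoordTensor R ι k :=
  LinearMap.funLeft R R fun m => m ∘ σ

theorem perm_apply (σ : Equiv.Perm (Fin k)) (t : CoordTensor R ι k) (m : Fin k → ι) :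
    perm σ t m = t (m ∘ σ) :=
  rfl

/-- The tensor product of two matrices, viewed as tensors of order two. -/
def prod : Matrix ι ι R →ₗ[R] Matrix ι ι R →ₗ[R] CoordTensor R ι 4 :=
  LinearMap.mk₂ R (fun p q m => p (m 0) (m 1) * q (m 2) (m 3))
    (fun _ _ _ => funext fun _ => add_mul _ _ _) (fun _ _ _ => funext fun _ => mul_assoc _ _ _)
    (fun _ _ _ => funext fun _ => mul_add _ _ _)
    (fun _ _ _ => funext fun _ => mul_left_comm _ _ _)

theorem prod_apply (p q : Matrix ι ι R) (m : Fin 4 → ι) :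
    prod p q m = p (m 0) (m 1) * q (m 2) (m 3) :=
  rfl

variable [Fintype ι]

/-- The action of a matrix on tensors as a derivation. -/
def deriv : Matrix ι ι R →ₗ[R] CoordTensor R ι k →ₗ[R] CoordTensor R ι k :=
  LinearMap.mk₂ R (fun x t m => ∑ i, ∑ a, x (m i) a * t (update m i a))
    (fun _ _ _ => by ext; simp [add_mul, Finset.sum_add_distrib])
    (fun _ _ _ => by ext; simp [mul_assoc, Finset.mul_sum])
    (fun _ _ _ => by ext; simp [mul_add, Finset.sum_add_distrib])
    (fun _ _ _ => by ext; simp [mul_left_comm, Finset.mul_sum])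

theorem deriv_apply (x : Matrix ι ι R) (t : CoordTensor R ι k) (m : Fin k → ι) :
    deriv x t m = ∑ i, ∑ a, x (m i) a * t (update m i a) :=
  rfl

theorem deriv_perm (x : Matrix ι ι R) (σ : Equiv.Perm (Fin k)) (t : CoordTensor R ι k) :
    deriv x (perm σ t) = perm σ (deriv x t) := by
  ext m
  simp only [perm_apply, deriv_apply]
  rw [← Equiv.sum_comp σ]
  exact Finset.sum_congr rfl fun i _ => Finset.sum_congr rfl fun a _ => by
    rw [update_comp_equiv, Equiv.symm_apply_apply, comp_apply]

theorem deriv_prod (x p q : Matrix ι ι R) :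
    deriv x (prod p q) = prod (x * p + p * x.transpose) q + prod p (x * q + q * x.transpose) := by
  ext m
  simp only [deriv_apply, prod_apply, Fin.sum_univ_four, Pi.add_apply, Matrix.add_apply,
    Matrix.mul_apply, Matrix.transpose_apply, update_apply, add_mul, mul_add, Finset.sum_mul,
    Finset.mul_sum]
  simp [mul_comm, mul_left_comm, add_assoc, mul_assoc]

theorem deriv_two (x : Matrix ι ι R) (p : Matrix ι ι R) (m : Fin 2 → ι) :
    deriv x (fun m => p (m 0) (m 1)) m = (x * p + p * x.transpose) (m 0) (m 1) := by
  simp [deriv_apply, Matrix.mul_apply, mul_comm]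

theorem deriv_transpose_dotProduct (x : Matrix ι ι R) (s t : CoordTensor R ι k) :
    deriv x.transpose s ⬝ᵥ t = s ⬝ᵥ deriv x t := by
  let f (i : Fin k) (p : (Fin k → ι) × ι) : (Fin k → ι) × ι := (update p.1 i p.2, p.1 i)
  have hf (i : Fin k) : Involutive (f i) := fun p => by simp [f]
  calc deriv x.transpose s ⬝ᵥ t
      = ∑ i, ∑ p : (Fin k → ι) × ι, x p.2 (p.1 i) * s (update p.1 i p.2) * t p.1 := by
        simp only [dotProduct, deriv_apply, Finset.sum_mul, Fintype.sum_prod_type,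
          Matrix.transpose_apply]
        exact Finset.sum_comm
    _ = ∑ i, ∑ p : (Fin k → ι) × ι, s p.1 * (x (p.1 i) p.2 * t (update p.1 i p.2)) := by
        refine Finset.sum_congr rfl fun i _ => Fintype.sum_equiv (hf i).toPerm _ _ fun p => ?_
        simp [f, mul_comm, ← mul_assoc]
    _ = s ⬝ᵥ deriv x t := by
        simp only [dotProduct, deriv_apply, Finset.mul_sum, Fintype.sum_prod_type]
        exact Finset.sum_comm

/-- The tensors that are killed by the derivations in `S`. -/
def invariants (k : ℕ) (S : Set (Matrix ι ι R)) : Submodule R (CoordTensor R ι k) :=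
  ⨅ x ∈ S, LinearMap.ker (deriv x)

theorem mem_invariants {S : Set (Matrix ι ι R)} {t : CoordTensor R ι k} :
    t ∈ invariants k S ↔ ∀ x ∈ S, deriv x t = 0 := by
  simp [invariants]

theorem invariants_span (S : Set (Matrix ι ι R)) :
    invariants k (Submodule.span R S : Set (Matrix ι ι R)) = invariants k S := by
  ext t
  have h := Submodule.span_le (s := S) (p := LinearMap.ker (deriv.flip t))
  simpa [Set.subset_def, SetLike.le_def, mem_invariants] using h

theorem perm_mem_invariants {S : Set (Matrix ι ι R)} {t : CoordTensor R ι k}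
    (ht : t ∈ invariants k S) (σ : Equiv.Perm (Fin k)) : perm σ t ∈ invariants k S :=
  mem_invariants.2 fun x hx => by rw [deriv_perm, mem_invariants.1 ht x hx, map_zero]

end CoordTensor

namespace CoordTensor

/-! ## Alternating tensors -/

variable {R ι : Type*} [CommRing R] {k : ℕ}

/-- The alternating tensors of order `k`. -/
def alternating (R ι : Type*) [CommRing R] (k : ℕ) : Submodule R (CoordTensor R ι k) where
  carrier := {t | ∀ σ, perm σ t = (Equiv.Perm.sign σ : ℤ) • t}
  zero_mem' σ := by simp
  add_mem' hs ht σ := by rw [map_add, hs σ, ht σ, smul_add]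
  smul_mem' c t ht σ := by rw [map_smul, ht σ, smul_comm]

theorem mem_alternating_of_swap {t : CoordTensor R ι (k + 1)}
    (ht : ∀ i : Fin k, perm (Equiv.swap i.castSucc i.succ) t = -t) :
    t ∈ alternating R ι (k + 1) := by
  intro σ
  have hσ : σ ∈ Submonoid.closure (Set.range fun i : Fin k => Equiv.swap i.castSucc i.succ) := by
    rw [Equiv.Perm.mclosure_swap_castSucc_succ]; trivial
  induction hσ using Submonoid.closure_induction with
  | mem _ h =>
    obtain ⟨i, rfl⟩ := h
    simp [ht, Equiv.Perm.sign_swap i.castSucc_lt_succ.ne]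
  | one => simp; rfl
  | mul σ τ _ _ hσ hτ =>
    have hmul : perm (σ * τ) t = perm σ (perm τ t) := rfl
    rw [hmul, hτ, map_zsmul, hσ, smul_smul, Equiv.Perm.sign_mul, Units.val_mul, mul_comm]

theorem perm_swap_of_mem_alternating {t : CoordTensor R ι k} (ht : t ∈ alternating R ι k)
    {i j : Fin k} (hij : i ≠ j) : perm (Equiv.swap i j) t = -t := by
  rw [ht, Equiv.Perm.sign_swap hij, Units.val_neg, Units.val_one, neg_one_zsmul]

/-- The cyclic permutation of the last three of four positions. -/
def cycle : Equiv.Perm (Fin 4) := Equiv.swap 1 2 * Equiv.swap 2 3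

/-- The cyclic sum of the first Bianchi identity. -/
def bianchi : CoordTensor R ι 4 →ₗ[R] CoordTensor R ι 4 :=
  LinearMap.id + perm cycle + perm (cycle * cycle)

theorem bianchi_apply (t : CoordTensor R ι 4) (a b c d : ι) :
    bianchi t ![a, b, c, d] = t ![a, b, c, d] + t ![a, c, d, b] + t ![a, d, b, c] := by
  have h : ![a, b, c, d] ∘ cycle = ![a, c, d, b] := by
    ext i; fin_cases i <;> rfl
  have h' : ![a, b, c, d] ∘ ⇑(cycle * cycle) = ![a, d, b, c] := by
    ext i; fin_cases i <;> rfl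
  simp only [bianchi, LinearMap.add_apply, LinearMap.id_apply, Pi.add_apply, perm_apply, h, h']

theorem bianchi_mem_alternating {t : CoordTensor R ι 4}
    (skew_left : ∀ a b c d, t ![b, a, c, d] = -t ![a, b, c, d])
    (skew_right : ∀ a b c d, t ![a, b, d, c] = -t ![a, b, c, d])
    (pair_comm : ∀ a b c d, t ![c, d, a, b] = t ![a, b, c, d]) :
    bianchi t ∈ alternating R ι 4 := by
  refine mem_alternating_of_swap fun i => ?_
  ext m
  obtain ⟨a, b, c, d, rfl⟩ : ∃ a b c d, m = ![a, b, c, d] :=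
    ⟨m 0, m 1, m 2, m 3, by ext i; fin_cases i <;> rfl⟩
  have h0 : ![a, b, c, d] ∘ Equiv.swap 0 1 = ![b, a, c, d] := by
    ext i; fin_cases i <;> rfl
  have h1 : ![a, b, c, d] ∘ Equiv.swap 1 2 = ![a, c, b, d] := by
    ext i; fin_cases i <;> rfl
  have h2 : ![a, b, c, d] ∘ Equiv.swap 2 3 = ![a, b, d, c] := by
    ext i; fin_cases i <;> rfl
  fin_cases i
  · change bianchi t (![a, b, c, d] ∘ Equiv.swap 0 1) = -bianchi t _
    rw [h0, bianchi_apply, bianchi_apply, skew_left a b, pair_comm d a, skew_left a d,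
      pair_comm a c, skew_right a c]
    ring
  · change bianchi t (![a, b, c, d] ∘ Equiv.swap 1 2) = -bianchi t _
    rw [h1, bianchi_apply, bianchi_apply, skew_right a c, skew_right a b, skew_right a d]
    ring
  · change bianchi t (![a, b, c, d] ∘ Equiv.swap 2 3) = -bianchi t _
    rw [h2, bianchi_apply, bianchi_apply, skew_right a b, skew_right a d, skew_right a c]
    ring

theorem bianchi_mem_invariants [Fintype ι] {S : Set (Matrix ι ι R)} {t : CoordTensor R ι 4}
    (ht : t ∈ invariants 4 S) : bianchi t ∈ invariants 4 S :=
  add_mem (add_mem ht (perm_mem_invariants ht _)) (perm_mem_invariants ht _)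

end CoordTensor

namespace Spin7

open CoordTensor

/-! ## Invariant tensors of the spin representation -/

/-- The tensors of order `k` on the spin representation that are invariant under `so(7)`. -/
noncomputable def spinInvariants (k : ℕ) : Submodule ℂ (CoordTensor ℂ (Finset (Fin 3)) k) :=
  invariants k (Set.range spinMatrix)

theorem spinInvariants_eq (k : ℕ) :
    spinInvariants k = invariants k (pauli ℂ '' (roots : Set Label)) := by
  rw [← invariants_span, ← range_spinMatrix]
  rfl

theorem mem_spinInvariants {k : ℕ} {t : CoordTensor ℂ (Finset (Fin 3)) k} :
    t ∈ spinInvariants k ↔ ∀ r ∈ roots, deriv (pauli ℂ r) t = 0 := by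
  rw [spinInvariants_eq, mem_invariants]
  exact Set.forall_mem_image

/-- The invariant symmetric bilinear form on spinors. -/
def form (R : Type*) [CommRing R] : Matrix (Finset (Fin 3)) (Finset (Fin 3)) R := pauli R formLabel

theorem form_mul_form (R : Type*) [CommRing R] : form R * form R = 1 := by
  have h : pauliSign formLabel formLabel = 1 := by decide
  rw [form, pauli_mul, h, symmDiff_self, pauli_bot, Int.cast_one, one_smul]

theorem form_mul_pauli_transpose {r : Label} (hr : r ∈ roots) :
    form ℂ * (pauli ℂ r).transpose = -(pauli ℂ r * form ℂ) := by
  rw [eq_neg_iff_add_eq_zero, form, pauli_mul_transpose, pauli_mul, ← add_smul, add_comm]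
  have h := congrArg (Int.cast : ℤ → ℂ) (lieCoeff_form r hr)
  push_cast at h
  rw [h, zero_smul]

theorem pauli_act_mul_form {r : Label} (hr : r ∈ roots) (q : Matrix _ _ ℂ) :
    pauli ℂ r * (q * form ℂ) + q * form ℂ * (pauli ℂ r).transpose =
      (pauli ℂ r * q - q * pauli ℂ r) * form ℂ := by
  rw [Matrix.mul_assoc q, form_mul_pauli_transpose hr]
  noncomm_ring

theorem linearIndependent_pauli : LinearIndependent ℂ (pauli ℂ : Label → _) :=
  linearIndependent_of_top_le_span_of_card_eq_finrank (span_range_pauli (Fin 3) ℂ).ge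
    (by simp [Module.finrank_matrix])

theorem exists_eq_smul_one_of_commute {q : Matrix (Finset (Fin 3)) (Finset (Fin 3)) ℂ}
    (hq : ∀ r ∈ roots, pauli ℂ r * q = q * pauli ℂ r) : ∃ c : ℂ, q = c • 1 := by
  obtain ⟨c, rfl⟩ := (Submodule.mem_span_range_iff_exists_fun ℂ).1
    (span_range_pauli (Fin 3) ℂ ▸ Submodule.mem_top : q ∈ Submodule.span ℂ (Set.range (pauli ℂ)))
  have hc : ∀ u ≠ ⊥, c u = 0 := by
    intro u hu
    obtain ⟨r, hr, hru⟩ := exists_lieCoeff_ne_zero u hu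
    have hsum : ∑ u, (c u * lieCoeff r u) • pauli ℂ (r ∆ u) = 0 := by
      simp only [mul_smul, ← pauli_mul_sub_mul, smul_sub, Finset.sum_sub_distrib, sub_eq_zero]
      simpa only [Finset.mul_sum, Finset.sum_mul, Matrix.mul_smul, Matrix.smul_mul] using hq r hr
    have hind := linearIndependent_pauli.comp (r ∆ ·) (symmDiff_right_injective r)
    exact (mul_eq_zero.1 (Fintype.linearIndependent_iff.1 hind _ hsum u)).resolve_right
      (Int.cast_ne_zero.2 hru)
  refine ⟨c ⊥, ?_⟩
  rw [Finset.sum_eq_single ⊥ (fun u _ hu => by rw [hc u hu, zero_smul]) (by simp), pauli_bot]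

theorem exists_eq_smul_form {t : CoordTensor ℂ (Finset (Fin 3)) 2} (ht : t ∈ spinInvariants 2) :
    ∃ c : ℂ, ∀ m, t m = c * form ℂ (m 0) (m 1) := by
  let p : Matrix (Finset (Fin 3)) (Finset (Fin 3)) ℂ := Matrix.of fun I J => t ![I, J]
  have htp : t = fun m => p (m 0) (m 1) := funext fun m =>
    congrArg t (by ext i; fin_cases i <;> rfl)
  have hp : p * form ℂ * form ℂ = p := by
    rw [Matrix.mul_assoc, form_mul_form, Matrix.mul_one]
  have hcomm : ∀ r ∈ roots, pauli ℂ r * (p * form ℂ) = p * form ℂ * pauli ℂ r := by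
    intro r hr
    have hact : pauli ℂ r * p + p * (pauli ℂ r).transpose = 0 := by
      ext I J
      have := congrFun (mem_spinInvariants.1 ht r hr) ![I, J]
      rwa [htp, deriv_two] at this
    have hF := pauli_act_mul_form hr (p * form ℂ)
    rw [hp, hact] at hF
    rw [← sub_eq_zero, ← Matrix.mul_one (_ - _), ← form_mul_form, ← Matrix.mul_assoc, ← hF,
      Matrix.zero_mul]
  obtain ⟨c, hc⟩ := exists_eq_smul_one_of_commute hcomm
  refine ⟨c, fun m => ?_⟩
  rw [htp, ← hp, hc, Matrix.smul_mul, Matrix.one_mul]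
  rfl

/-- The coefficient of a tensor of order four at `(u, v)`, in terms of the basis of products of two
matrices `pauli u * form`: the twist by the invariant form turns the tensor square of the spin
representation into the adjoint action on matrices. -/
noncomputable def pauliCoeff (u v : Label) : CoordTensor ℂ (Finset (Fin 3)) 4 →ₗ[ℂ] ℂ :=
  dotProductBilin ℂ ℂ (prod (pauli ℂ u * form ℂ) (pauli ℂ v * form ℂ))

theorem deriv_prod_mul_form {r : Label} (hr : r ∈ roots) (u v : Label) :
    deriv (pauli ℂ r) (prod (pauli ℂ u * form ℂ) (pauli ℂ v * form ℂ)) =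
      (lieCoeff r u : ℂ) • prod (pauli ℂ (r ∆ u) * form ℂ) (pauli ℂ v * form ℂ) +
        (lieCoeff r v : ℂ) • prod (pauli ℂ u * form ℂ) (pauli ℂ (r ∆ v) * form ℂ) := by
  simp only [deriv_prod, pauli_act_mul_form hr, pauli_mul_sub_mul, Matrix.smul_mul, map_smul,
    LinearMap.smul_apply]

theorem pauliCoeff_relation {r : Label} (hr : r ∈ roots) {t : CoordTensor ℂ (Finset (Fin 3)) 4}
    (ht : t ∈ spinInvariants 4) (u v : Label) :
    lieCoeff r u * pauliCoeff (r ∆ u) v t + lieCoeff r v * pauliCoeff u (r ∆ v) t = 0 := by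
  have hadj := deriv_transpose_dotProduct (pauli ℂ r)
    (prod (pauli ℂ u * form ℂ) (pauli ℂ v * form ℂ)) t
  rw [mem_spinInvariants.1 ht r hr, dotProduct_zero, pauli_transpose, map_smul,
    LinearMap.smul_apply, smul_dotProduct, smul_eq_zero_iff_right
      (Int.cast_ne_zero.2 (pauliSign_ne_zero r r)), deriv_prod_mul_form hr] at hadj
  simpa [pauliCoeff, add_dotProduct, smul_dotProduct] using hadj

theorem eq_zero_of_pauliCoeff {t : CoordTensor ℂ (Finset (Fin 3)) 4}
    (ht : ∀ u v, pauliCoeff u v t = 0) : t = 0 := by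
  have hspan : Submodule.span ℂ (Set.range fun u : Label => pauli ℂ u * form ℂ) = ⊤ := by
    have hsurj : LinearMap.range (LinearMap.mulRight ℂ (form ℂ)) = ⊤ :=
      LinearMap.range_eq_top.2 fun p => ⟨p * form ℂ, by
        rw [LinearMap.mulRight_apply, Matrix.mul_assoc, form_mul_form, Matrix.mul_one]⟩
    rw [← hsurj, LinearMap.range_eq_map, ← span_range_pauli (Fin 3) ℂ, Submodule.map_span,
      ← Set.range_comp]
    rfl
  let pair := (prod (R := ℂ) (ι := Finset (Fin 3))).compr₂ ((dotProductBilin ℂ ℂ).flip t)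
  have hpair : pair = 0 :=
    LinearMap.ext_on_range hspan fun u => LinearMap.ext_on_range hspan fun v => ht u v
  ext m
  have hm : prod (Matrix.single (m 0) (m 1) (1 : ℂ)) (Matrix.single (m 2) (m 3) 1) =
      Pi.single m 1 := by
    ext n
    have hn : n = m ↔ (m 2 = n 2 ∧ m 3 = n 3) ∧ m 0 = n 0 ∧ m 1 = n 1 := by
      simp only [funext_iff, Fin.forall_fin_succ, eq_comm (a := n _)]
      simp only [Fin.succ_zero_eq_one, Fin.isValue, IsEmpty.forall_iff, and_true]
      tauto
    simp only [prod_apply, Matrix.single_apply, Pi.single_apply, hn, mul_ite, mul_one, mul_zero,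
      ← ite_and]
  have := LinearMap.congr_fun₂ hpair (Matrix.single (m 0) (m 1) 1) (Matrix.single (m 2) (m 3) 1)
  change prod _ _ ⬝ᵥ t = 0 at this
  simpa [hm] using this

theorem pauliCoeff_of_ne {t : CoordTensor ℂ (Finset (Fin 3)) 4} (ht : t ∈ spinInvariants 4)
    {u v : Label} (huv : u ≠ v) : pauliCoeff u v t = 0 := by
  obtain ⟨r, hr, ⟨hu, hv⟩ | ⟨hu, hv⟩⟩ := exists_lieCoeff_separating huv
  · have h := pauliCoeff_relation hr ht (r ∆ u) v
    simpa [hv, symmDiff_symmDiff_cancel_left, lieCoeff_symmDiff_self, hu, pauliSign_ne_zero] using h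
  · have h := pauliCoeff_relation hr ht u (r ∆ v)
    simpa [hu, symmDiff_symmDiff_cancel_left, lieCoeff_symmDiff_self, hv, pauliSign_ne_zero] using h

theorem pauliCoeff_self_eq_zero {t : CoordTensor ℂ (Finset (Fin 3)) 4} (ht : t ∈ spinInvariants 4)
    (hrep : ∀ k, pauliCoeff (orbitRep k) (orbitRep k) t = 0) (u : Label) :
    pauliCoeff u u t = 0 := by
  refine label_induction (p := fun u => pauliCoeff u u t = 0) hrep (fun r hr u hru hu => ?_) u
  have h := pauliCoeff_relation hr ht (r ∆ u) u
  simpa [symmDiff_symmDiff_cancel_left, hu, lieCoeff_symmDiff_self, hru, pauliSign_ne_zero] using h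

theorem finrank_spinInvariants_four_le : Module.finrank ℂ (spinInvariants 4) ≤ 4 := by
  let f : spinInvariants 4 →ₗ[ℂ] Fin 4 → ℂ :=
    LinearMap.pi fun k => pauliCoeff (orbitRep k) (orbitRep k) ∘ₗ (spinInvariants 4).subtype
  have hf : Function.Injective f := by
    refine (injective_iff_map_eq_zero f).2 fun t ht => Subtype.ext (eq_zero_of_pauliCoeff ?_)
    intro u v
    rcases eq_or_ne u v with rfl | huv
    · exact pauliCoeff_self_eq_zero t.2 (fun k => congrFun ht k) u
    · exact pauliCoeff_of_ne t.2 huv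
  simpa using LinearMap.finrank_le_finrank_of_injective hf

end Spin7

namespace Spin7

open CoordTensor

/-- The vector representation inside the tensor square of the spin representation, viewed as an
invariant element of its tensor square. It is the sum of the squares of the generators `gen i`, each
normalized by the sign of its square and twisted by the invariant form. -/
def vectorTensor (R : Type*) [CommRing R] : CoordTensor R (Finset (Fin 3)) 4 :=
  ∑ i, (pauliSign (gen i) (gen i) : R) •
    prod (pauli R (gen i ∆ formLabel)) (pauli R (gen i ∆ formLabel))

/-- The Cayley form: the alternating four-form on spinors that is invariant under `so(7)`. -/
def cayley (R : Type*) [CommRing R] : CoordTensor R (Finset (Fin 3)) 4 := bianchi (vectorTensor R)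

theorem pauli_gen_symmDiff_form_swap (R : Type*) [CommRing R] (i : Fin 7) (I J : Finset (Fin 3)) :
    pauli R (gen i ∆ formLabel) J I = -pauli R (gen i ∆ formLabel) I J := by
  have hsign : ∀ i, pauliSign (gen i ∆ formLabel) (gen i ∆ formLabel) = -1 := by decide
  have := congrFun₂ (pauli_transpose R (gen i ∆ formLabel)) I J
  rwa [hsign, Int.cast_neg, Int.cast_one, neg_one_smul] at this

theorem cayley_mem_alternating (R : Type*) [CommRing R] :
    cayley R ∈ alternating R (Finset (Fin 3)) 4 := by
  refine bianchi_mem_alternating ?_ ?_ ?_ <;> intro a b c d <;>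
    simp only [vectorTensor, Finset.sum_apply, Pi.smul_apply, prod_apply, ← Finset.sum_neg_distrib]
      <;> refine Finset.sum_congr rfl fun i _ => ?_
  · rw [← smul_neg, ← neg_mul]
    exact congrArg (fun x => _ • (x * _)) (pauli_gen_symmDiff_form_swap R i a b)
  · rw [← smul_neg, ← mul_neg]
    exact congrArg (fun x => _ • (_ * x)) (pauli_gen_symmDiff_form_swap R i c d)
  · exact congrArg _ (mul_comm _ _)

theorem cayley_eq_intCast (R : Type*) [CommRing R] (m : Fin 4 → Finset (Fin 3)) :
    cayley R m = (cayley ℤ m : ℤ) := by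
  simp [cayley, bianchi, vectorTensor, perm_apply, prod_apply, pauli_eq_intCast R]

theorem prod_pauli_mul_form (R : Type*) [CommRing R] (u : Label) :
    prod (pauli R u * form R) (pauli R u * form R) =
      prod (pauli R (u ∆ formLabel)) (pauli R (u ∆ formLabel)) := by
  rw [form, pauli_mul, map_smul, map_smul, LinearMap.smul_apply, smul_smul, ← Int.cast_mul,
    pauliSign_mul_self, Int.cast_one, one_smul]

theorem lieCoeff_gen_symmDiff_gen : ∀ i j k, k ≠ i → k ≠ j →
    lieCoeff (gen i ∆ gen j) (gen k) = 0 := by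
  decide +kernel

theorem lieCoeff_gen_symmDiff_gen_add : ∀ i j, i ≠ j →
    pauliSign (gen i) (gen i) * lieCoeff (gen i ∆ gen j) (gen i) +
      pauliSign (gen j) (gen j) * lieCoeff (gen i ∆ gen j) (gen j) = 0 := by
  decide +kernel

theorem vectorTensor_mem_spinInvariants : vectorTensor ℂ ∈ spinInvariants 4 := by
  rw [mem_spinInvariants]
  intro r hr
  obtain ⟨i, j, hij, rfl⟩ := mem_roots.1 hr
  have hother : ∀ k, k ≠ i ∧ k ≠ j →
      deriv (pauli ℂ (gen i ∆ gen j)) ((pauliSign (gen k) (gen k) : ℂ) •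
        prod (pauli ℂ (gen k) * form ℂ) (pauli ℂ (gen k) * form ℂ)) = 0 := by
    intro k hk
    simp [deriv_prod_mul_form hr, lieCoeff_gen_symmDiff_gen i j k hk.1 hk.2]
  have hsign := congrArg (Int.cast : ℤ → ℂ) (lieCoeff_gen_symmDiff_gen_add i j hij.ne)
  push_cast at hsign
  simp only [vectorTensor, ← prod_pauli_mul_form, map_sum]
  rw [Fintype.sum_eq_add i j hij.ne hother, map_smul, map_smul, deriv_prod_mul_form hr,
    deriv_prod_mul_form hr, symmDiff_comm (gen i ∆ gen j) (gen i), symmDiff_symmDiff_cancel_left,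
    symmDiff_symmDiff_cancel_right, ← smul_add, ← smul_add, smul_smul, smul_smul,
    add_comm (prod (pauli ℂ (gen j) * _) _), ← add_smul, hsign, zero_smul]

theorem cayley_mem_spinInvariants : cayley ℂ ∈ spinInvariants 4 :=
  bianchi_mem_invariants vectorTensor_mem_spinInvariants

theorem prod_form_mem_spinInvariants : prod (form ℂ) (form ℂ) ∈ spinInvariants 4 :=
  mem_spinInvariants.2 fun r hr => by
    have h := pauli_act_mul_form hr 1
    rw [Matrix.one_mul, Matrix.mul_one, Matrix.one_mul, sub_self, Matrix.zero_mul] at h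
    rw [deriv_prod, h, map_zero, map_zero, LinearMap.zero_apply, add_zero]

/-- A basis of the invariant tensors of order four: the three products of two copies of the
invariant form, and the Cayley form. -/
def invariantTensor (R : Type*) [CommRing R] : Fin 4 → CoordTensor R (Finset (Fin 3)) 4 :=
  ![prod (form R) (form R), perm cycle (prod (form R) (form R)),
    perm (cycle * cycle) (prod (form R) (form R)), cayley R]

/-- Four tuples of basis spinors that separate the invariant tensors of order four: the product of
two copies of the invariant form vanishes at all permutations of the last one. -/
def testTuple : Fin 4 → Fin 4 → Finset (Fin 3) :=
  ![![∅, ∅, Finset.univ, Finset.univ], ![∅, Finset.univ, ∅, Finset.univ],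
    ![∅, Finset.univ, Finset.univ, ∅], ![∅, {0, 1}, {0, 2}, {1, 2}]]

theorem invariantTensor_testTuple : ∀ i j, invariantTensor ℤ i (testTuple j) =
    ![![0, 1, 1, 0], ![1, 0, 1, 0], ![1, 1, 0, 0], ![0, 0, 0, -6]] i j := by
  decide +kernel

theorem invariantTensor_eq_intCast (R : Type*) [CommRing R] (i : Fin 4)
    (m : Fin 4 → Finset (Fin 3)) : invariantTensor R i m = (invariantTensor ℤ i m : ℤ) := by
  have hform (I J : Finset (Fin 3)) : form R I J = (form ℤ I J : ℤ) := pauli_eq_intCast R _ I J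
  fin_cases i
  · simp [invariantTensor, prod_apply, hform]
  · simp [invariantTensor, perm_apply, prod_apply, hform]
  · simp [invariantTensor, perm_apply, prod_apply, hform]
  · exact cayley_eq_intCast R m

theorem invariantTensor_mem_spinInvariants (i : Fin 4) :
    invariantTensor ℂ i ∈ spinInvariants 4 := by
  fin_cases i
  · exact prod_form_mem_spinInvariants
  · exact perm_mem_invariants prod_form_mem_spinInvariants cycle
  · exact perm_mem_invariants prod_form_mem_spinInvariants (cycle * cycle)
  · exact cayley_mem_spinInvariants

theorem eq_zero_of_sum_testTuple {c : Fin 4 → ℂ}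
    (hc : ∀ j, ∑ i, c i * invariantTensor ℂ i (testTuple j) = 0) : c = 0 := by
  simp only [invariantTensor_eq_intCast ℂ, invariantTensor_testTuple, Fin.sum_univ_four] at hc
  have h0 : c 1 + c 2 = 0 := by simpa using hc 0
  have h1 : c 0 + c 2 = 0 := by simpa using hc 1
  have h2 : c 0 + c 1 = 0 := by simpa using hc 2
  have h3 : c 3 = 0 := by simpa using hc 3
  ext i
  fin_cases i
  · change c 0 = 0
    linear_combination (h1 + h2 - h0) / 2
  · change c 1 = 0
    linear_combination (h0 + h2 - h1) / 2
  · change c 2 = 0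
    linear_combination (h0 + h1 - h2) / 2
  · exact h3

theorem linearIndependent_invariantTensor : LinearIndependent ℂ (invariantTensor ℂ) := by
  refine Fintype.linearIndependent_iff.2 fun c hc => congrFun (eq_zero_of_sum_testTuple fun j => ?_)
  simpa using congrFun hc (testTuple j)

theorem span_range_invariantTensor :
    Submodule.span ℂ (Set.range (invariantTensor ℂ)) = spinInvariants 4 := by
  refine Submodule.eq_of_le_of_finrank_le ?_ ?_
  · rw [Submodule.span_le, Set.range_subset_iff]
    exact invariantTensor_mem_spinInvariants
  · rw [finrank_span_eq_card linearIndependent_invariantTensor]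
    exact finrank_spinInvariants_four_le

theorem eq_zero_of_testTuple {t : CoordTensor ℂ (Finset (Fin 3)) 4} (ht : t ∈ spinInvariants 4)
    (h : ∀ j, t (testTuple j) = 0) : t = 0 := by
  rw [← span_range_invariantTensor] at ht
  obtain ⟨c, rfl⟩ := (Submodule.mem_span_range_iff_exists_fun ℂ).1 ht
  have hc : c = 0 := eq_zero_of_sum_testTuple fun j => by simpa using h j
  simp [hc]

theorem apply_testTuple_three_comp {t : CoordTensor ℂ (Finset (Fin 3)) 4}
    (ht : t ∈ spinInvariants 4) (σ : Equiv.Perm (Fin 4)) :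
    t (testTuple 3 ∘ σ) = (Equiv.Perm.sign σ : ℤ) * t (testTuple 3) := by
  have hform : ∀ (i : Fin 3) (σ : Equiv.Perm (Fin 4)),
      invariantTensor ℤ i.castSucc (testTuple 3 ∘ σ) = 0 := by
    decide +kernel
  rw [← span_range_invariantTensor] at ht
  induction ht using Submodule.span_induction with
  | mem _ h =>
    obtain ⟨i, rfl⟩ := h
    induction i using Fin.lastCases with
    | last => exact (congrFun (cayley_mem_alternating ℂ σ) (testTuple 3)).trans (zsmul_eq_mul _ _)
    | cast i =>
      have h1 := hform i 1
      rw [Equiv.Perm.coe_one, Function.comp_id] at h1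
      rw [invariantTensor_eq_intCast, hform, invariantTensor_eq_intCast, h1, Int.cast_zero,
        mul_zero]
  | zero => simp
  | add s t _ _ hs ht => rw [Pi.add_apply, Pi.add_apply, hs, ht, mul_add]
  | smul c t _ ht => rw [Pi.smul_apply, Pi.smul_apply, ht, smul_eq_mul, smul_eq_mul, mul_left_comm]

end Spin7

/-! ## Change of coordinates -/

namespace CoordTensor

open Function
open scoped Matrix

variable {R ι κ μ : Type*} [CommRing R] {k : ℕ}

/-- The matrix of the tensor product of the linear maps with matrices `P i`. -/
def piKronecker (P : Fin k → Matrix κ ι R) : Matrix (Fin k → κ) (Fin k → ι) R :=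
  Matrix.of fun m n => ∏ i, P i (m i) (n i)

theorem piKronecker_apply (P : Fin k → Matrix κ ι R) (m : Fin k → κ) (n : Fin k → ι) :
    piKronecker P m n = ∏ i, P i (m i) (n i) :=
  rfl

theorem piKronecker_one [DecidableEq ι] :
    (piKronecker fun _ : Fin k => (1 : Matrix ι ι R)) = 1 := by
  ext m n
  simp only [piKronecker_apply, Matrix.one_apply, Finset.prod_boole, Finset.mem_univ,
    forall_const, funext_iff]

theorem piKronecker_update_apply (P : Fin k → Matrix κ ι R) (i : Fin k) (x : Matrix κ ι R)
    (m : Fin k → κ) (n : Fin k → ι) : piKronecker (update P i x) m n =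
      (∏ j ∈ Finset.univ.erase i, P j (m j) (n j)) * x (m i) (n i) := by
  rw [piKronecker_apply, ← Finset.prod_erase_mul _ _ (Finset.mem_univ i), update_self]
  congr 1
  exact Finset.prod_congr rfl fun j hj => by rw [update_of_ne (Finset.ne_of_mem_erase hj)]

variable [Fintype ι]

theorem piKronecker_mul (P : Fin k → Matrix κ ι R) (Q : Fin k → Matrix ι μ R) :
    (piKronecker fun i => P i * Q i) = piKronecker P * piKronecker Q := by
  ext m n
  simp only [piKronecker_apply, Matrix.mul_apply, Finset.prod_univ_sum, Fintype.piFinset_univ,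
    Finset.prod_mul_distrib]

theorem piKronecker_update_one_apply [DecidableEq ι] (i : Fin k) (x : Matrix ι ι R)
    (m n : Fin k → ι) : piKronecker (update (fun _ => 1) i x) m n =
      ∑ a, if n = update m i a then x (m i) a else 0 := by
  have hsum : (∑ a, if n = update m i a then x (m i) a else 0) =
      if ∀ j ≠ i, n j = m j then x (m i) (n i) else 0 := by
    simp only [eq_update_iff, ite_and]
    simp
  simp only [hsum, piKronecker_update_apply, Matrix.one_apply, Finset.prod_boole]
  simp [eq_comm]

theorem deriv_eq_sum_mulVec [DecidableEq ι] (x : Matrix ι ι R) (t : CoordTensor R ι k) :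
    deriv x t = ∑ i, piKronecker (update (fun _ => 1) i x) *ᵥ t := by
  ext m : 1
  rw [deriv_apply, Finset.sum_apply]
  refine Finset.sum_congr rfl fun i _ => ?_
  simp only [Matrix.mulVec, dotProduct, piKronecker_update_one_apply, Finset.sum_mul, ite_mul,
    zero_mul]
  rw [Finset.sum_comm]
  simp

/-- The `k`-th tensor power of the linear map with matrix `P`. -/
def map (P : Matrix κ ι R) : CoordTensor R ι k →ₗ[R] CoordTensor R κ k :=
  (piKronecker fun _ => P).mulVecLin

theorem map_apply (P : Matrix κ ι R) (t : CoordTensor R ι k) (m : Fin k → κ) :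
    map P t m = ∑ n, (∏ i, P (m i) (n i)) * t n :=
  rfl

theorem map_one [DecidableEq ι] (t : CoordTensor R ι k) : map (1 : Matrix ι ι R) t = t := by
  rw [map, piKronecker_one, Matrix.mulVecLin_one, LinearMap.id_apply]

theorem map_map [Fintype κ] (P : Matrix μ κ R) (Q : Matrix κ ι R) (t : CoordTensor R ι k) :
    map P (map Q t) = map (P * Q) t := by
  rw [map, map, map, piKronecker_mul, Matrix.mulVecLin_mul, LinearMap.comp_apply]

theorem perm_map (σ : Equiv.Perm (Fin k)) (P : Matrix κ ι R) (t : CoordTensor R ι k) :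
    perm σ (map P t) = map P (perm σ t) := by
  ext m
  simp only [perm_apply, map_apply]
  refine Fintype.sum_equiv (σ.arrowCongr (.refl ι)) _ _ fun n => ?_
  congr 1
  · rw [← Equiv.prod_comp σ fun i => P (m i) _]
    simp
  · simp [comp_def]

theorem map_deriv_eq_sum_mulVec (P : Matrix κ ι R) (x : Matrix ι ι R)
    (t : CoordTensor R ι k) :
    map P (deriv x t) = ∑ i, piKronecker (update (fun _ => P) i (P * x)) *ᵥ t := by
  classical
  simp only [map, deriv_eq_sum_mulVec, map_sum, Matrix.mulVecLin_apply, Matrix.mulVec_mulVec,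
    ← piKronecker_mul]
  refine Finset.sum_congr rfl fun i _ => ?_
  congr
  ext j : 1
  rcases eq_or_ne j i with rfl | h <;> simp [*]

theorem deriv_map [Fintype κ] {P : Matrix κ ι R} {x : Matrix κ κ R} {y : Matrix ι ι R}
    (h : x * P = P * y) (t : CoordTensor R ι k) : deriv x (map P t) = map P (deriv y t) := by
  classical
  rw [map_deriv_eq_sum_mulVec, ← h, deriv_eq_sum_mulVec]
  simp only [map, Matrix.mulVecLin_apply, Matrix.mulVec_mulVec, ← piKronecker_mul]
  refine Finset.sum_congr rfl fun i _ => ?_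
  congr
  ext j : 1
  rcases eq_or_ne j i with rfl | h <;> simp [*]

theorem hasDerivAt_map {𝕜 𝔸 : Type*} [NontriviallyNormedField 𝕜] [NormedCommRing 𝔸]
    [NormedAlgebra 𝕜 𝔸] {P : 𝕜 → Matrix κ ι 𝔸} {x : Matrix ι ι 𝔸} {s : 𝕜}
    (hP : ∀ i j, HasDerivAt (fun s => P s i j) ((P s * x) i j) s) (t : CoordTensor 𝔸 ι k)
    (m : Fin k → κ) : HasDerivAt (fun s => map (P s) t m) (map (P s) (deriv x t) m) s := by
  rw [map_deriv_eq_sum_mulVec, Finset.sum_apply]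
  simp only [Matrix.mulVec, dotProduct]
  rw [Finset.sum_comm]
  simp only [← Finset.sum_mul, map_apply]
  refine .fun_sum fun n _ => .mul_const ?_ (t n)
  convert HasDerivAt.fun_finsetProd fun i _ => hP (m i) (n i) using 2 with i
  rw [piKronecker_update_apply, smul_eq_mul]

theorem map_mem_alternating {t : CoordTensor R ι k} (ht : t ∈ alternating R ι k)
    (P : Matrix κ ι R) : map P t ∈ alternating R κ k := fun σ => by
  rw [perm_map, ht σ, map_zsmul]

section Basis

variable {M : Type*} [AddCommGroup M] [Module R M] [Fintype κ]
  (β : Module.Basis ι R M) (γ : Module.Basis κ R M)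

theorem map_toMatrix_map_toMatrix (t : CoordTensor R ι k) :
    map (β.toMatrix γ) (map (γ.toMatrix β) t) = t := by
  classical
  rw [map_map, Module.Basis.toMatrix_mul_toMatrix_flip, map_one]

variable [DecidableEq ι] [DecidableEq κ]

theorem map_toMatrix_mem_invariants {S : Set (Module.End R M)} {t : CoordTensor R ι k}
    (ht : t ∈ invariants k (LinearMap.toMatrix β β '' S)) :
    map (γ.toMatrix β) t ∈ invariants k (LinearMap.toMatrix γ γ '' S) := by
  refine mem_invariants.2 ?_
  rintro _ ⟨X, hX, rfl⟩
  have hcomm : LinearMap.toMatrix γ γ X * γ.toMatrix β =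
      γ.toMatrix β * LinearMap.toMatrix β β X := by
    rw [linearMap_toMatrix_mul_basis_toMatrix, basis_toMatrix_mul_linearMap_toMatrix]
  rw [deriv_map hcomm, mem_invariants.1 ht _ ⟨X, hX, rfl⟩, map_zero]

theorem finrank_alternating_inf_invariants_eq (k : ℕ) (S : Set (Module.End R M)) :
    Module.finrank R ↥(alternating R ι k ⊓ invariants k (LinearMap.toMatrix β β '' S)) =
      Module.finrank R ↥(alternating R κ k ⊓ invariants k (LinearMap.toMatrix γ γ '' S)) :=
  LinearEquiv.finrank_eq <| .ofLinearMap
    ((map (γ.toMatrix β)).restrict fun _ ht =>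
      ⟨map_mem_alternating ht.1 _, map_toMatrix_mem_invariants β γ ht.2⟩)
    ((map (β.toMatrix γ)).restrict fun _ ht =>
      ⟨map_mem_alternating ht.1 _, map_toMatrix_mem_invariants γ β ht.2⟩)
    (LinearMap.ext fun t => Subtype.ext <| map_toMatrix_map_toMatrix γ β (t : CoordTensor R κ k))
    (LinearMap.ext fun t => Subtype.ext <| map_toMatrix_map_toMatrix β γ (t : CoordTensor R ι k))

end Basis

end CoordTensor

/-! ## Coordinates of alternating maps -/

section AlternatingMap

variable {R A M ι : Type*} [CommRing R] [CommRing A] [Algebra R A] [AddCommGroup M] [Module R M]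

/-- The values of alternating maps on the tuples of basis vectors. -/
noncomputable def alternatingCoord (b : Module.Basis ι R M) (k : ℕ) :
    (M [⋀^Fin k]→ₗ[R] A) →ₗ[A] CoordTensor A ι k where
  toFun ω m := ω (b ∘ m)
  map_add' _ _ := rfl
  map_smul' _ _ := rfl

variable {k : ℕ} (b : Module.Basis ι R M)

theorem alternatingCoord_apply (ω : M [⋀^Fin k]→ₗ[R] A) (m : Fin k → ι) :
    alternatingCoord b k ω m = ω (b ∘ m) :=
  rfl

theorem apply_eq_sum_alternatingCoord [Fintype ι] (ω : M [⋀^Fin k]→ₗ[R] A) (v : Fin k → M) :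
    ω v = ∑ m, (∏ i, b.repr (v i) (m i)) • alternatingCoord b k ω m := by
  classical
  have hv : v = fun i => ∑ j, b.repr (v i) j • b j := funext fun i => (b.sum_repr (v i)).symm
  calc ω v = ω.toMultilinearMap fun i => ∑ j, b.repr (v i) j • b j := congrArg ω hv
    _ = ∑ m : Fin k → ι, ω.toMultilinearMap fun i => b.repr (v i) (m i) • b (m i) :=
      ω.toMultilinearMap.map_sum _
    _ = _ := Finset.sum_congr rfl fun m _ => ω.toMultilinearMap.map_smul_univ _ _

theorem alternatingCoord_injective :
    Function.Injective (alternatingCoord (A := A) b k) := fun _ _ h =>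
  b.ext_alternating fun m _ => congrFun h m

theorem alternatingCoord_mem_alternating (ω : M [⋀^Fin k]→ₗ[R] A) :
    alternatingCoord b k ω ∈ CoordTensor.alternating A ι k := fun σ => by
  ext m
  rw [CoordTensor.perm_apply, alternatingCoord_apply, ← Function.comp_assoc, ω.map_perm]
  rfl

theorem exists_multilinearMap_apply_basis [Finite ι] (t : CoordTensor A ι k) :
    ∃ μ : MultilinearMap R (fun _ : Fin k => M) A, ∀ m, μ (b ∘ m) = t m := by
  classical
  have := Fintype.ofFinite ι
  refine ⟨∑ n, (MultilinearMap.mkPiRing R (Fin k) (t n)).compLinearMap fun i => b.coord (n i),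
    fun m => ?_⟩
  simp only [sum_apply, MultilinearMap.compLinearMap_apply,
    MultilinearMap.mkPiRing_apply, Function.comp_apply, Module.Basis.coord_apply,
    Module.Basis.repr_self, Finsupp.single_apply, Finset.prod_boole, Finset.mem_univ,
    forall_const, ← funext_iff, ite_smul, one_smul, zero_smul, Finset.sum_ite_eq, if_true]

theorem range_alternatingCoord [Finite ι] [IsAddTorsionFree A] :
    LinearMap.range (alternatingCoord (A := A) b k) = CoordTensor.alternating A ι k := by
  refine le_antisymm ?_ fun t ht => ?_
  · rintro _ ⟨ω, rfl⟩
    exact alternatingCoord_mem_alternating b ω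
  obtain ⟨μ, hμ⟩ := exists_multilinearMap_apply_basis b t
  have hswap {i j : Fin k} (hij : i ≠ j) : μ.domDomCongr (Equiv.swap i j) = -μ :=
    Module.Basis.ext_multilinear (fun _ => b) fun m => by
      have h := congrFun (CoordTensor.perm_swap_of_mem_alternating ht hij) m
      rwa [CoordTensor.perm_apply, Pi.neg_apply, ← hμ, ← hμ] at h
  refine ⟨{ μ with map_eq_zero_of_eq' := fun v i j hv hij => ?_ }, funext hμ⟩
  have hfix : (fun l => v (Equiv.swap i j l)) = v := by
    change v ∘ Equiv.swap i j = v
    rw [Equiv.comp_swap_eq_update, hv, Function.update_eq_self, ← hv, Function.update_eq_self]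
  have h := congrArg (fun f => f v) (hswap hij)
  simp only [MultilinearMap.domDomCongr_apply, hfix, neg_apply] at h
  exact self_eq_neg.1 h

end AlternatingMap

/-! ## Descent of the ground field -/

section Descent

variable (K : Type*) {L κ : Type*} [Field K] [Field L] [Algebra K L]

/-- The points over `K` of a subspace of the coordinate space over an extension `L` of `K`. -/
def pointsOver (W : Submodule L (κ → L)) : Submodule K (κ → K) :=
  (W.restrictScalars K).comap ((Algebra.linearMap K L).compLeft κ)

variable {K}

theorem mem_pointsOver {W : Submodule L (κ → L)} {q : κ → K} :
    q ∈ pointsOver K W ↔ algebraMap K L ∘ q ∈ W :=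
  Iff.rfl

variable [Finite κ] {W : Submodule L (κ → L)}

theorem span_image_pointsOver (hW : ∀ w ∈ W, ∀ f : L →ₗ[K] L, f ∘ w ∈ W) :
    Submodule.span L ((algebraMap K L ∘ ·) '' (pointsOver K W : Set (κ → K))) = W := by
  refine le_antisymm (Submodule.span_le.2 (Set.image_subset_iff.2 fun _ h => h)) fun w hw => ?_
  classical
  have := Fintype.ofFinite κ
  let B := Module.Basis.ofVectorSpace K L
  let F := Finset.univ.biUnion fun j => (B.repr (w j)).support
  have hsum : w = ∑ i ∈ F, B i • (algebraMap K L ∘ B.coord i ∘ w) := by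
    ext j
    have hF : (B.repr (w j)).support ⊆ F :=
      Finset.subset_biUnion_of_mem (fun j => (B.repr (w j)).support) (Finset.mem_univ j)
    calc w j = ∑ i ∈ F, B.repr (w j) i • B i := by
          conv_lhs => rw [← B.linearCombination_repr (w j)]
          exact Finsupp.sum_of_support_subset _ hF _ fun _ _ => zero_smul _ _
      _ = _ := by simp [Algebra.smul_def, mul_comm]
  rw [hsum]
  exact sum_mem fun i _ => Submodule.smul_mem _ _ <| Submodule.subset_span
    ⟨_, hW w hw (Algebra.linearMap K L ∘ₗ B.coord i), rfl⟩

theorem finrank_pointsOver (hW : ∀ w ∈ W, ∀ f : L →ₗ[K] L, f ∘ w ∈ W) :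
    Module.finrank K (pointsOver K W) = Module.finrank L W := by
  let v := Module.finBasis K (pointsOver K W)
  let incl := (Algebra.linearMap K L).compLeft κ
  have hv : LinearIndependent K fun i => (v i : κ → K) :=
    v.linearIndependent.map' (pointsOver K W).subtype (Submodule.ker_subtype _)
  have hli : LinearIndependent L fun i => incl (v i) :=
    linearIndependent_algebraMap_comp_iff.2 hv
  have hspanK :
      (pointsOver K W).map incl = Submodule.span K (Set.range fun i => incl (v i)) := by
    have h := congrArg (Submodule.map (incl ∘ₗ (pointsOver K W).subtype)) v.span_eq
    rwa [Submodule.map_span, ← Set.range_comp, Submodule.map_comp, Submodule.map_subtype_top,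
      eq_comm] at h
  have hspan : W = Submodule.span L (Set.range fun i => incl (v i)) :=
    calc W = Submodule.span L ((pointsOver K W).map incl : Set (κ → L)) :=
          (span_image_pointsOver hW).symm
      _ = _ := by rw [hspanK, Submodule.span_span_of_tower]
  rw [congrArg (fun W : Submodule L (κ → L) => Module.finrank L W) hspan,
    finrank_span_eq_card hli, Fintype.card_fin]

theorem finrank_eq_of_mem_iff_exists_pointsOver {E : Type*} [AddCommGroup E] [Module K E]
    {S : Submodule K E} {f : E →ₗ[K] κ → L} (hf : Function.Injective f)
    (hW : ∀ w ∈ W, ∀ f : L →ₗ[K] L, f ∘ w ∈ W) (hrange : (W : Set (κ → L)) ⊆ Set.range f)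
    (hS : ∀ x, x ∈ S ↔ ∃ q ∈ pointsOver K W, algebraMap K L ∘ q = f x) :
    Module.finrank K S = Module.finrank L W := by
  let incl := (Algebra.linearMap K L).compLeft κ
  have hincl : Function.Injective incl := fun _ _ h =>
    funext fun i => (algebraMap K L).injective (congrFun h i)
  have hmap : S.map f = (pointsOver K W).map incl := by
    ext y
    constructor
    · rintro ⟨x, hx, rfl⟩
      exact (hS x).1 hx
    · rintro ⟨q, hq, rfl⟩
      obtain ⟨x, hx⟩ := hrange hq
      exact ⟨x, (hS x).2 ⟨q, hq, hx.symm⟩, hx⟩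
  rw [(S.equivMapOfInjective f hf).finrank_eq, hmap,
    ← ((pointsOver K W).equivMapOfInjective incl hincl).finrank_eq, finrank_pointsOver hW]

end Descent

/-! ## Two copies of the spin representation -/

namespace CoordTensor

open Function
open scoped Kronecker

variable {R ι κ : Type*} [CommRing R] {k : ℕ}

/-- The component of a tensor on a direct sum of copies of one module, indexed by `κ`, whose `i`-th
factor lies in the copy `c i`. -/
def component (c : Fin k → κ) : CoordTensor R (κ × ι) k →ₗ[R] CoordTensor R ι k :=
  LinearMap.funLeft R R fun m i => (c i, m i)

theorem component_apply (c : Fin k → κ) (t : CoordTensor R (κ × ι) k) (m : Fin k → ι) :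
    component c t m = t fun i => (c i, m i) :=
  rfl

theorem eq_zero_of_component {t : CoordTensor R (κ × ι) k}
    (ht : ∀ c : Fin k → κ, component c t = 0) : t = 0 :=
  funext fun m => congrFun (ht fun i => (m i).1) fun i => (m i).2

theorem component_comp_apply_comp {t : CoordTensor R (κ × ι) k} (ht : t ∈ alternating R (κ × ι) k)
    (c : Fin k → κ) (m : Fin k → ι) (σ : Equiv.Perm (Fin k)) :
    component (c ∘ σ) t (m ∘ σ) = (Equiv.Perm.sign σ : ℤ) * component c t m :=
  (congrFun (ht σ) fun i => (c i, m i)).trans (zsmul_eq_mul _ _)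

variable [Fintype ι] [Fintype κ] [DecidableEq κ]

theorem component_deriv (x : Matrix ι ι R) (t : CoordTensor R (κ × ι) k) (c : Fin k → κ) :
    component c (deriv ((1 : Matrix κ κ R) ⊗ₖ x) t) = deriv x (component c t) := by
  ext m
  have hupdate (i : Fin k) (a : ι) : update (fun j => (c j, m j)) i (c i, a) =
      fun j => (c j, update m i a j) := by
    ext j : 1
    obtain rfl | hj := eq_or_ne j i
    · rw [update_self, update_self]
    · rw [update_of_ne hj, update_of_ne hj]
  simp only [component_apply, deriv_apply, Fintype.sum_prod_type, Matrix.kronecker_apply,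
    Matrix.one_apply, ite_mul, one_mul, zero_mul]
  refine Finset.sum_congr rfl fun i _ => ?_
  rw [Finset.sum_comm]
  exact Finset.sum_congr rfl fun a _ => by rw [Finset.sum_ite_eq, if_pos (Finset.mem_univ _),
    hupdate]

theorem mem_invariants_one_kronecker {S : Set (Matrix ι ι R)} {t : CoordTensor R (κ × ι) k} :
    t ∈ invariants k ((fun x => (1 : Matrix κ κ R) ⊗ₖ x) '' S) ↔
      ∀ c : Fin k → κ, component c t ∈ invariants k S := by
  simp only [mem_invariants, Set.forall_mem_image, ← component_deriv]
  refine ⟨fun h c x hx => by rw [h hx, map_zero], fun h x hx => ?_⟩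
  exact eq_zero_of_component fun c => h c x hx

end CoordTensor

namespace Spin7

open CoordTensor
open scoped Kronecker

/-- The alternating tensors of order `k` on two copies of the spin representation that are invariant
under `so(7)`. -/
noncomputable def twoSpinForms (k : ℕ) : Submodule ℂ (CoordTensor ℂ (Fin 2 × Finset (Fin 3)) k) :=
  alternating ℂ (Fin 2 × Finset (Fin 3)) k ⊓
    invariants k ((fun x => (1 : Matrix (Fin 2) (Fin 2) ℂ) ⊗ₖ x) '' Set.range spinMatrix)

theorem mem_twoSpinForms {k : ℕ} {t : CoordTensor ℂ (Fin 2 × Finset (Fin 3)) k} :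
    t ∈ twoSpinForms k ↔ t ∈ alternating ℂ (Fin 2 × Finset (Fin 3)) k ∧
      ∀ c : Fin k → Fin 2, component c t ∈ spinInvariants k :=
  and_congr_right' mem_invariants_one_kronecker

/-- The invariant symplectic form on two copies of the spin representation. -/
def sympForm : Matrix (Fin 2 × Finset (Fin 3)) (Fin 2 × Finset (Fin 3)) ℂ :=
  !![0, 1; -1, 0] ⊗ₖ form ℂ

theorem form_symm (I J : Finset (Fin 3)) : form ℂ J I = form ℂ I J := by
  have h : pauliSign formLabel formLabel = 1 := by decide
  have := congrFun₂ (pauli_transpose ℂ formLabel) I J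
  rwa [h, Int.cast_one, one_smul] at this

theorem form_empty_apply (I : Finset (Fin 3)) :
    form ℂ ∅ I = if I = Finset.univ then 1 else 0 := by
  have h : ∀ I, form ℤ ∅ I = if I = Finset.univ then 1 else 0 := by decide
  rw [form, pauli_eq_intCast, ← form, h]
  exact_mod_cast rfl

theorem form_empty_univ : form ℂ ∅ Finset.univ = 1 :=
  (form_empty_apply _).trans (if_pos rfl)

theorem component_comp_apply_empty_univ {t : CoordTensor ℂ (Fin 2 × Finset (Fin 3)) 2}
    (ht : t ∈ twoSpinForms 2) (a b : Fin 2) :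
    component ![b, a] t ![∅, Finset.univ] = -component ![a, b] t ![∅, Finset.univ] := by
  obtain ⟨halt, hinv⟩ := mem_twoSpinForms.1 ht
  obtain ⟨c, hc⟩ := exists_eq_smul_form (hinv ![b, a])
  have h := component_comp_apply_comp halt ![a, b] ![∅, Finset.univ] (Equiv.swap 0 1)
  have hab : ![a, b] ∘ Equiv.swap 0 1 = ![b, a] := by
    ext i; fin_cases i <;> rfl
  rw [hab, hc, Equiv.Perm.sign_swap (by decide)] at h
  rw [hc]
  simpa [form_symm] using h

theorem eq_zero_of_apply_empty_univ {t : CoordTensor ℂ (Fin 2 × Finset (Fin 3)) 2}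
    (ht : t ∈ twoSpinForms 2) (h : component ![0, 1] t ![∅, Finset.univ] = 0) : t = 0 := by
  have hswap := component_comp_apply_empty_univ ht
  have hzero : ∀ a b, component ![a, b] t ![∅, Finset.univ] = 0 := by
    simp only [Fin.forall_fin_two]
    exact ⟨⟨self_eq_neg.1 (hswap 0 0), h⟩, by rw [hswap, h, neg_zero], self_eq_neg.1 (hswap 1 1)⟩
  refine eq_zero_of_component fun c => ?_
  obtain ⟨a, ha⟩ := exists_eq_smul_form ((mem_twoSpinForms.1 ht).2 c)
  have hc : c = ![c 0, c 1] := by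
    ext i; fin_cases i <;> rfl
  have ha0 : a = 0 := by
    have := ha ![∅, Finset.univ]
    rw [hc, hzero] at this
    simpa [form_empty_univ] using this.symm
  ext m
  rw [ha, ha0, zero_mul, Pi.zero_apply]

theorem sympForm_skew (p q : Fin 2 × Finset (Fin 3)) : sympForm q p = -sympForm p q := by
  have hsign : ∀ a b : Fin 2, !![0, 1; -1, (0 : ℂ)] b a = -!![0, 1; -1, 0] a b := by
    simp [Fin.forall_fin_two]
  rw [sympForm, Matrix.kronecker_apply, Matrix.kronecker_apply, hsign, form_symm, neg_mul]

theorem sympForm_mem_twoSpinForms : (fun m => sympForm (m 0) (m 1)) ∈ twoSpinForms 2 := by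
  refine mem_twoSpinForms.2 ⟨mem_alternating_of_swap fun i => ?_, fun c => ?_⟩
  · ext m
    fin_cases i
    exact sympForm_skew (m 0) (m 1)
  · have hform : (fun m => form ℂ (m 0) (m 1)) ∈ spinInvariants 2 :=
      mem_spinInvariants.2 fun r hr => by
        have h := pauli_act_mul_form hr 1
        rw [Matrix.one_mul, Matrix.mul_one, Matrix.one_mul, sub_self, Matrix.zero_mul] at h
        ext m
        rw [deriv_two, h]
        rfl
    exact Submodule.smul_mem _ (!![0, 1; -1, (0 : ℂ)] (c 0) (c 1)) hform

theorem finrank_twoSpinForms_two : Module.finrank ℂ (twoSpinForms 2) = 1 := by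
  have hval : component ![0, 1] (fun m => sympForm (m 0) (m 1)) ![∅, Finset.univ] = 1 := by
    simp [component_apply, sympForm, form_empty_univ]
  refine finrank_eq_one ⟨_, sympForm_mem_twoSpinForms⟩ (fun h => ?_) fun ⟨t, ht⟩ =>
    ⟨component ![0, 1] t ![∅, Finset.univ], Subtype.ext (sub_eq_zero.1 ?_)⟩
  · have h0 : (fun m : Fin 2 → _ => sympForm (m 0) (m 1)) = 0 := congrArg Subtype.val h
    rw [h0, map_zero] at hval
    exact zero_ne_one hval
  · refine eq_zero_of_apply_empty_univ
      (sub_mem (Submodule.smul_mem _ _ sympForm_mem_twoSpinForms) ht) ?_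
    change component _ t _ * component ![0, 1] (fun m => sympForm (m 0) (m 1)) _ - _ = 0
    rw [hval, mul_one]
    exact sub_self _

/-- The number of factors of a tensor component that lie in the second copy. -/
def weight (c : Fin 4 → Fin 2) : Fin 5 := Fin.ofNat 5 (∑ i, (c i : ℕ))

/-- The choice of copies of the given weight in which the second copy comes first. -/
def weightWord (j : Fin 5) : Fin 4 → Fin 2 := fun i => if (i : ℕ) < j then 1 else 0

theorem weight_comp (c : Fin 4 → Fin 2) (σ : Equiv.Perm (Fin 4)) : weight (c ∘ σ) = weight c :=
  congrArg (Fin.ofNat 5) (Equiv.sum_comp σ fun i => (c i : ℕ))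

theorem weight_weightWord : ∀ j, weight (weightWord j) = j := by
  decide

theorem exists_weightWord_comp : ∀ c, ∃ j, ∃ σ : Equiv.Perm (Fin 4), weightWord j ∘ σ = c := by
  decide +kernel


theorem component_comp_apply_testTuple_three {t : CoordTensor ℂ (Fin 2 × Finset (Fin 3)) 4}
    (ht : t ∈ twoSpinForms 4) (c : Fin 4 → Fin 2) (σ : Equiv.Perm (Fin 4)) :
    component (c ∘ σ) t (testTuple 3) = component c t (testTuple 3) := by
  obtain ⟨halt, hinv⟩ := mem_twoSpinForms.1 ht
  have h := component_comp_apply_comp halt c (testTuple 3) σ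
  rw [apply_testTuple_three_comp (hinv _)] at h
  exact mul_left_cancel₀ (Int.cast_ne_zero.2 (Units.ne_zero _)) h

theorem component_apply_testTuple_zero {t : CoordTensor ℂ (Fin 2 × Finset (Fin 3)) 4}
    (ht : t ∈ alternating ℂ (Fin 2 × Finset (Fin 3)) 4)
    (h : component ![0, 1, 0, 1] t (testTuple 0) = 0) (c : Fin 4 → Fin 2) :
    component c t (testTuple 0) = 0 := by
  have hswap (i j : Fin 4) (hij : i ≠ j) (hfix : testTuple 0 ∘ Equiv.swap i j = testTuple 0)
      (c : Fin 4 → Fin 2) :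
      component (c ∘ Equiv.swap i j) t (testTuple 0) = -component c t (testTuple 0) := by
    have := component_comp_apply_comp ht c (testTuple 0) (Equiv.swap i j)
    rw [hfix, Equiv.Perm.sign_swap hij] at this
    simpa using this
  have h01 := hswap 0 1 (by decide) (by decide)
  have h23 := hswap 2 3 (by decide) (by decide)
  have hcases : ∀ c : Fin 4 → Fin 2, c ∘ Equiv.swap 0 1 = c ∨ c ∘ Equiv.swap 2 3 = c ∨
      c = ![0, 1, 0, 1] ∨ c = ![0, 1, 0, 1] ∘ Equiv.swap 0 1 ∨
      c = ![0, 1, 0, 1] ∘ Equiv.swap 2 3 ∨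
      c = (![0, 1, 0, 1] ∘ Equiv.swap 0 1) ∘ Equiv.swap 2 3 := by
    decide +kernel
  obtain hc | hc | hc | hc | hc | hc := hcases c
  · exact self_eq_neg.1 (by rw [← h01, hc])
  · exact self_eq_neg.1 (by rw [← h23, hc])
  all_goals simp only [hc, h01, h23, h, neg_zero]

theorem eq_zero_of_component_apply {t : CoordTensor ℂ (Fin 2 × Finset (Fin 3)) 4}
    (ht : t ∈ twoSpinForms 4) (hw : ∀ j, component (weightWord j) t (testTuple 3) = 0)
    (h : component ![0, 1, 0, 1] t (testTuple 0) = 0) : t = 0 := by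
  obtain ⟨halt, hinv⟩ := mem_twoSpinForms.1 ht
  refine eq_zero_of_component fun c => eq_zero_of_testTuple (hinv c) fun j => ?_
  induction j using Fin.lastCases with
  | last =>
    obtain ⟨j, σ, rfl⟩ := exists_weightWord_comp c
    exact (component_comp_apply_testTuple_three ht _ σ).trans (hw j)
  | cast j =>
    have hperm : ∀ j : Fin 3, ∃ σ : Equiv.Perm (Fin 4),
        testTuple 0 ∘ σ = testTuple j.castSucc := by
      decide +kernel
    obtain ⟨σ, hσ⟩ := hperm j
    have hc := component_comp_apply_comp halt (c ∘ σ.symm) (testTuple 0) σ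
    rwa [component_apply_testTuple_zero halt h, mul_zero, hσ, Function.comp_assoc,
      Equiv.symm_comp_self, Function.comp_id] at hc

/-- The invariant four-form on two copies of the spin representation whose component at `c` is a
multiple of the Cayley form depending on the weight of `c` only. -/
noncomputable def weightedCayley (y : Fin 5 → ℂ) : CoordTensor ℂ (Fin 2 × Finset (Fin 3)) 4 :=
  fun m => y (weight fun i => (m i).1) * cayley ℂ fun i => (m i).2

theorem component_weightedCayley (y : Fin 5 → ℂ) (c : Fin 4 → Fin 2) :
    component c (weightedCayley y) = y (weight c) • cayley ℂ :=
  rfl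

theorem weightedCayley_mem_twoSpinForms (y : Fin 5 → ℂ) : weightedCayley y ∈ twoSpinForms 4 := by
  refine mem_twoSpinForms.2 ⟨fun σ => ?_, fun c => ?_⟩
  · ext m
    have hw := weight_comp (fun i => (m i).1) σ
    have hc := congrFun (cayley_mem_alternating ℂ σ) fun i => (m i).2
    change y (weight ((fun i => (m i).1) ∘ σ)) * perm σ (cayley ℂ) (fun i => (m i).2) = _
    rw [hw, hc, Pi.smul_apply, mul_smul_comm]
    rfl
  · rw [component_weightedCayley]
    exact Submodule.smul_mem _ _ cayley_mem_spinInvariants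

theorem bianchi_sympForm_mem_twoSpinForms :
    bianchi (prod sympForm sympForm) ∈ twoSpinForms 4 := by
  refine Submodule.mem_inf.2 ⟨bianchi_mem_alternating (fun a b c d => ?_) (fun a b c d => ?_)
    (fun a b c d => mul_comm _ _), bianchi_mem_invariants (mem_invariants_one_kronecker.2
      fun c => ?_)⟩
  · simp only [prod_apply, Matrix.cons_val, sympForm_skew a b, neg_mul]
  · simp only [prod_apply, Matrix.cons_val, sympForm_skew c d, mul_neg]
  · have hc : component c (prod sympForm sympForm) = (!![0, 1; -1, (0 : ℂ)] (c 0) (c 1) *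
        !![0, 1; -1, 0] (c 2) (c 3)) • prod (form ℂ) (form ℂ) := by
      ext m
      exact mul_mul_mul_comm _ _ _ _
    rw [hc]
    exact Submodule.smul_mem _ _ prod_form_mem_spinInvariants

/-- The coordinates of an invariant four-form: a component of each weight, evaluated at the tuple
that detects the Cayley form, and the component that detects the square of the symplectic form. -/
noncomputable def fourFormCoord :
    CoordTensor ℂ (Fin 2 × Finset (Fin 3)) 4 →ₗ[ℂ] (Fin 5 → ℂ) × ℂ :=
  (LinearMap.pi fun j => LinearMap.proj (testTuple 3) ∘ₗ component (weightWord j)).prod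
    (LinearMap.proj (testTuple 0) ∘ₗ component ![0, 1, 0, 1])

theorem cayley_testTuple_zero : cayley ℂ (testTuple 0) = 0 :=
  (invariantTensor_eq_intCast ℂ 3 (testTuple 0)).trans (by rw [invariantTensor_testTuple]; simp)

theorem cayley_testTuple_three : cayley ℂ (testTuple 3) = -6 :=
  (invariantTensor_eq_intCast ℂ 3 (testTuple 3)).trans (by rw [invariantTensor_testTuple]; simp)

theorem fourFormCoord_weightedCayley (y : Fin 5 → ℂ) :
    fourFormCoord (weightedCayley y) = (-6 • y, 0) := by
  refine Prod.ext (funext fun j => ?_) ?_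
  · change component (weightWord j) (weightedCayley y) (testTuple 3) = -6 • y j
    rw [component_weightedCayley, Pi.smul_apply, cayley_testTuple_three, weight_weightWord,
      smul_eq_mul, mul_comm, zsmul_eq_mul]
    norm_num
  · change component ![0, 1, 0, 1] (weightedCayley y) (testTuple 0) = 0
    rw [component_weightedCayley, Pi.smul_apply, cayley_testTuple_zero, smul_zero]

theorem fourFormCoord_bianchi_sympForm :
    fourFormCoord (bianchi (prod sympForm sympForm)) = (0, -1) := by
  have hne : ({0, 1} : Finset (Fin 3)) ≠ Finset.univ ∧ ({0, 2} : Finset (Fin 3)) ≠ Finset.univ ∧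
      ({1, 2} : Finset (Fin 3)) ≠ Finset.univ ∧ (∅ : Finset (Fin 3)) ≠ Finset.univ := by
    decide
  have htuple (c : Fin 4 → Fin 2) (m : Fin 4 → Finset (Fin 3)) : (fun i => (c i, m i)) =
      ![(c 0, m 0), (c 1, m 1), (c 2, m 2), (c 3, m 3)] := by
    ext i : 1; fin_cases i <;> rfl
  refine Prod.ext (funext fun j => ?_) ?_
  · change component (weightWord j) (bianchi (prod sympForm sympForm)) (testTuple 3) = 0
    simp [component_apply, htuple, bianchi_apply, prod_apply, sympForm, testTuple,
      form_empty_apply, hne]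
  · change component ![0, 1, 0, 1] (bianchi (prod sympForm sympForm)) (testTuple 0) = -1
    simp [component_apply, htuple, bianchi_apply, prod_apply, sympForm, testTuple,
      form_empty_apply, hne]

theorem finrank_twoSpinForms_four : Module.finrank ℂ (twoSpinForms 4) = 6 := by
  have hbij : Function.Bijective (fourFormCoord ∘ₗ (twoSpinForms 4).subtype) := by
    constructor
    · refine (injective_iff_map_eq_zero _).2 fun ⟨t, ht⟩ h => Subtype.ext ?_
      exact eq_zero_of_component_apply ht (congrFun (congrArg Prod.fst h)) (congrArg Prod.snd h)
    · rintro ⟨y, z⟩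
      refine ⟨⟨weightedCayley ((-6 : ℂ)⁻¹ • y) + (-z) • bianchi (prod sympForm sympForm),
        add_mem (weightedCayley_mem_twoSpinForms _)
          (Submodule.smul_mem _ _ bianchi_sympForm_mem_twoSpinForms)⟩, ?_⟩
      change fourFormCoord (_ + _) = _
      rw [map_add, map_smul, fourFormCoord_weightedCayley, fourFormCoord_bianchi_sympForm]
      ext <;> simp
  simpa using (LinearEquiv.ofBijective _ hbij).finrank_eq

end Spin7

/-! ## The Lie algebra of the Hodge group -/

theorem hasDerivAt_aeval {𝕜 𝔸 R σ : Type*} [NontriviallyNormedField 𝕜] [NormedCommRing 𝔸]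
    [NormedAlgebra 𝕜 𝔸] [CommSemiring R] [Algebra R 𝔸] [Fintype σ] {x : 𝕜 → σ → 𝔸} {x' : σ → 𝔸}
    {s : 𝕜} (hx : ∀ i, HasDerivAt (fun s => x s i) (x' i) s) (P : MvPolynomial σ R) :
    HasDerivAt (fun s => MvPolynomial.aeval (x s) P)
      (∑ i, MvPolynomial.aeval (x s) (MvPolynomial.pderiv i P) * x' i) s := by
  classical
  induction P using MvPolynomial.induction_on with
  | C r => simpa using hasDerivAt_const s (algebraMap R 𝔸 r)
  | add P Q hP hQ => simpa [add_mul, Finset.sum_add_distrib] using hP.fun_add hQ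
  | mul_X P i hP =>
    simp only [map_mul, MvPolynomial.aeval_X]
    convert! hP.fun_mul (hx i) using 1
    simp only [MvPolynomial.pderiv_mul, map_add, map_mul, MvPolynomial.aeval_X, add_mul,
      Finset.sum_add_distrib, Finset.sum_mul, MvPolynomial.pderiv_X]
    congr 1
    · exact Finset.sum_congr rfl fun _ _ => mul_right_comm _ _ _
    · simp [Pi.single_apply, apply_ite]

namespace ComplexAbelianVariety

section Coordinates

variable {V : Type*} [NormedAddCommGroup V] [NormedSpace ℂ V] {n : ℕ}
  (b : Module.Basis (Fin n) ℝ V)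

/-- The basis of `H¹(A, ℂ)` dual to a real basis of `V`. -/
noncomputable def h1Basis : Module.Basis (Fin n) ℂ (H1 V) :=
  .ofEquivFun (b.constr ℂ).symm

theorem h1Basis_repr (ω : H1 V) (i : Fin n) : (h1Basis b).repr ω i = ω (b i) := by
  simp [h1Basis, Module.Basis.ofEquivFun_repr_apply]

theorem h1Basis_apply (i : Fin n) (v : V) : h1Basis b i v = b.repr v i := by
  have h : h1Basis b i = Complex.ofRealCLM.toLinearMap ∘ₗ b.coord i := b.ext fun j => by
    rw [← h1Basis_repr, Module.Basis.repr_self]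
    simp [Finsupp.single_apply, eq_comm, apply_ite]
  rw [h]
  rfl

/-- The matrix of an endomorphism of `H¹(A, ℂ)` in the basis dual to a real basis of `V`. -/
noncomputable abbrev endMatrix : Module.End ℂ (H1 V) ≃ₗ[ℂ] Matrix (Fin n) (Fin n) ℂ :=
  LinearMap.toMatrix (h1Basis b) (h1Basis b)

theorem endMatrix_apply (X : Module.End ℂ (H1 V)) (i j : Fin n) :
    endMatrix b X i j = X (h1Basis b j) (b i) := by
  rw [endMatrix, LinearMap.toMatrix_apply, h1Basis_repr]

theorem apply_eq_sum_endMatrix (X : Module.End ℂ (H1 V)) (ω : H1 V) (v : V) :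
    X ω v = ∑ i, ∑ j, (b.repr v i : ℂ) * endMatrix b X i j * ω (b j) := by
  have hX i : X ω (b i) = ∑ j, endMatrix b X i j * ω (b j) := by
    rw [← h1Basis_repr, ← LinearMap.toMatrix_mulVec_repr (h1Basis b) (h1Basis b)]
    simp only [Matrix.mulVec, dotProduct, h1Basis_repr]
  conv_lhs => rw [← b.sum_repr v, map_sum]
  simp only [map_smul, Complex.real_smul, hX, Finset.mul_sum, mul_assoc]

theorem hasDerivAt_endMatrix_line (X : Module.End ℂ (H1 V)) (i j : Fin n) :
    HasDerivAt (fun s : ℂ => endMatrix b (1 + s • X) i j) (endMatrix b X i j) 0 := by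
  simp only [map_add, map_smul, Matrix.add_apply, Matrix.smul_apply, smul_eq_mul]
  simpa using ((hasDerivAt_id (0 : ℂ)).mul_const (endMatrix b X i j)).const_add (endMatrix b 1 i j)

/-- Pull-back of classes in `H¹(A, ℂ)` along a real-linear endomorphism of `V`. -/
noncomputable def pullback (f : Module.End ℝ V) : Module.End ℂ (H1 V) :=
  f.lcomp ℂ ℂ

theorem pullback_apply (f : Module.End ℝ V) (ω : H1 V) (v : V) : pullback f ω v = ω (f v) :=
  rfl

theorem endMatrix_pullback (f : Module.End ℝ V) (i j : Fin n) :
    endMatrix b (pullback f) i j = b.repr (f (b i)) j := by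
  rw [endMatrix_apply, pullback_apply, h1Basis_apply]

end Coordinates

section HodgeCircle

variable (V : Type*) [NormedAddCommGroup V] [NormedSpace ℂ V]

/-- The derivative at `1` of the homomorphism `h : S¹ → GL(H¹(A, ℂ))`. -/
noncomputable def hodgeDeriv : Module.End ℂ (H1 V) :=
  pullback (DistribSMul.toLinearMap ℝ V Complex.I)

theorem hodgeDeriv_mul_self : hodgeDeriv V * hodgeDeriv V = -1 := by
  ext ω v
  change ω (Complex.I • Complex.I • v) = -ω v
  rw [smul_smul, Complex.I_mul_I, neg_one_smul, map_neg]

theorem hodgeCircle_eq_pullback (z : Circle) :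
    (hodgeCircle V z : Module.End ℂ (H1 V)) = pullback (DistribSMul.toLinearMap ℝ V (z : ℂ)) :=
  rfl

theorem hodgeCircle_exp (s : ℝ) : (hodgeCircle V (Circle.exp s) : Module.End ℂ (H1 V)) =
    (Real.cos s : ℂ) • 1 + (Real.sin s : ℂ) • hodgeDeriv V := by
  ext ω v
  have h : (Circle.exp s : ℂ) • v = Real.cos s • v + Real.sin s • (Complex.I • v) := by
    rw [Circle.coe_exp, Complex.exp_mul_I, add_smul, mul_smul, ← Complex.ofReal_cos,
      ← Complex.ofReal_sin, Complex.coe_smul, Complex.coe_smul]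
  change ω ((Circle.exp s : ℂ) • v) =
    (Real.cos s : ℂ) * ω v + (Real.sin s : ℂ) * ω (Complex.I • v)
  rw [h, map_add, map_smul, map_smul, Complex.real_smul, Complex.real_smul]

theorem hasDerivAt_endMatrix_hodgeCircle {n : ℕ} (b : Module.Basis (Fin n) ℝ V) (s : ℝ)
    (i j : Fin n) :
    HasDerivAt (fun s : ℝ => endMatrix b (hodgeCircle V (Circle.exp s)) i j)
      ((endMatrix b (hodgeCircle V (Circle.exp s)) * endMatrix b (hodgeDeriv V)) i j) s := by
  have hmul : (hodgeCircle V (Circle.exp s) : Module.End ℂ (H1 V)) * hodgeDeriv V =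
      (-Real.sin s : ℂ) • 1 + (Real.cos s : ℂ) • hodgeDeriv V := by
    rw [hodgeCircle_exp, add_mul, smul_mul_assoc, smul_mul_assoc, hodgeDeriv_mul_self, one_mul,
      smul_neg, neg_smul (M := Module.End ℂ (H1 V)), add_comm]
  rw [endMatrix, ← LinearMap.toMatrix_mul, hmul]
  simp only [hodgeCircle_exp, map_add, map_smul, Matrix.add_apply, Matrix.smul_apply, smul_eq_mul]
  refine .add (.mul_const ?_ _) (.mul_const (Real.hasDerivAt_sin s).ofReal_comp _)
  simpa using (Real.hasDerivAt_cos s).ofReal_comp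

end HodgeCircle

section RationalPolynomials

variable {V : Type*} [NormedAddCommGroup V] [NormedSpace ℂ V] [FiniteDimensional ℂ V]
  {A : ComplexAbelianVariety V}

variable (A) in
/-- A real basis of `V` that generates the lattice. -/
def IsLatticeBasis {n : ℕ} (b : Module.Basis (Fin n) ℝ V) : Prop :=
  Submodule.span ℤ (Set.range b) = A.lattice

variable (A) in
theorem exists_isLatticeBasis : ∃ (n : ℕ) (b : Module.Basis (Fin n) ℝ V), A.IsLatticeBasis b := by
  have := A.discrete
  have : IsZLattice ℝ A.lattice := ⟨A.span_eq_top⟩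
  have : Module.Free ℤ A.lattice := ZLattice.module_free ℝ _
  have : Module.Finite ℤ A.lattice := ZLattice.module_finite ℝ _
  exact ⟨_, (Module.finBasis ℤ A.lattice).ofZLatticeBasis ℝ _,
    Module.Basis.ofZLatticeBasis_span ℝ _ _⟩

variable {n : ℕ} {b : Module.Basis (Fin n) ℝ V}

theorem IsLatticeBasis.mem (hb : A.IsLatticeBasis b) (i : Fin n) : b i ∈ A.lattice :=
  hb ▸ Submodule.subset_span ⟨i, rfl⟩

theorem IsLatticeBasis.mem_iff (hb : A.IsLatticeBasis b) {v : V} :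
    v ∈ A.lattice ↔ ∀ i, ∃ N : ℤ, b.repr v i = N := by
  rw [← hb, Module.Basis.mem_span_iff_repr_mem]
  simp [eq_comm]

theorem IsLatticeBasis.h1Basis_mem (hb : A.IsLatticeBasis b) (i : Fin n) :
    h1Basis b i ∈ A.H1Rat := fun v hv => by
  obtain ⟨N, hN⟩ := hb.mem_iff.1 hv i
  exact ⟨N, by rw [h1Basis_apply, hN]; push_cast; rfl⟩

theorem IsLatticeBasis.ratPolynomials_eq_adjoin (hb : A.IsLatticeBasis b) :
    A.ratPolynomials =
      Algebra.adjoin ℚ (Set.range fun (p : Fin n × Fin n) X => endMatrix b X p.1 p.2) := by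
  refine le_antisymm (Algebra.adjoin_le ?_) (Algebra.adjoin_mono ?_)
  · rintro _ ⟨ω, hω, v, hv, rfl⟩
    choose r hr using fun j => hω _ (hb.mem j)
    choose N hN using hb.mem_iff.1 hv
    have hF : (fun X : Module.End ℂ (H1 V) => X ω v) =
        ∑ i, ∑ j, (N i * r j : ℚ) • fun X => endMatrix b X i j := by
      funext X
      simp only [apply_eq_sum_endMatrix b X, hr, hN, Finset.sum_apply, Pi.smul_apply, Rat.smul_def]
      push_cast
      simp only [mul_right_comm]
    rw [hF]
    exact sum_mem fun i _ => sum_mem fun j _ => Subalgebra.smul_mem _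
      (Algebra.subset_adjoin (Set.mem_range_self (i, j))) _
  · rintro _ ⟨p, rfl⟩
    exact ⟨_, hb.h1Basis_mem p.2, _, hb.mem p.1, funext fun X => endMatrix_apply b X p.1 p.2⟩

theorem IsLatticeBasis.exists_mvPolynomial (hb : A.IsLatticeBasis b)
    {F : Module.End ℂ (H1 V) → ℂ} (hF : F ∈ A.ratPolynomials) :
    ∃ P : MvPolynomial (Fin n × Fin n) ℚ,
      ∀ X, F X = MvPolynomial.aeval (fun p => endMatrix b X p.1 p.2) P := by
  rw [hb.ratPolynomials_eq_adjoin, Algebra.adjoin_range_eq_range_aeval] at hF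
  obtain ⟨P, rfl⟩ := hF
  exact ⟨P, fun X =>
    MvPolynomial.comp_aeval_apply _ (Pi.evalAlgHom ℚ (fun _ : Module.End ℂ (H1 V) => ℂ) X) P⟩

end RationalPolynomials

end ComplexAbelianVariety

namespace ComplexAbelianVariety

variable {V : Type*} [NormedAddCommGroup V] [NormedSpace ℂ V] [FiniteDimensional ℂ V]
  {A : ComplexAbelianVariety V} {n : ℕ} {b : Module.Basis (Fin n) ℝ V}

theorem IsLatticeBasis.exists_differential (hb : A.IsLatticeBasis b)
    {F : Module.End ℂ (H1 V) → ℂ} (hF : F ∈ A.ratPolynomials) :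
    ∃ q : Fin n × Fin n → ℚ, ∀ (𝕜 : Type) [NontriviallyNormedField 𝕜] [NormedAlgebra 𝕜 ℂ]
      (g : 𝕜 → Module.End ℂ (H1 V)) (X : Module.End ℂ (H1 V)), g 0 = 1 →
      (∀ i j, HasDerivAt (fun s => endMatrix b (g s) i j) (endMatrix b X i j) 0) →
      HasDerivAt (fun s => F (g s)) (∑ p, endMatrix b X p.1 p.2 * q p) 0 := by
  obtain ⟨P, hP⟩ := hb.exists_mvPolynomial hF
  refine ⟨fun p => MvPolynomial.eval (fun p => (1 : Matrix (Fin n) (Fin n) ℚ) p.1 p.2)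
    (MvPolynomial.pderiv p P), fun 𝕜 _ _ g X hg hX => ?_⟩
  have hone : (fun p : Fin n × Fin n => endMatrix b (g 0) p.1 p.2) =
      fun p => algebraMap ℚ ℂ ((1 : Matrix (Fin n) (Fin n) ℚ) p.1 p.2) := by
    rw [hg, endMatrix, LinearMap.toMatrix_one, ← Matrix.map_one (algebraMap ℚ ℂ) (map_zero _)
      (map_one _)]
    rfl
  have hvalue (Q : MvPolynomial (Fin n × Fin n) ℚ) :
      MvPolynomial.aeval (fun p => endMatrix b (g 0) p.1 p.2) Q =
        (MvPolynomial.eval (fun p => (1 : Matrix (Fin n) (Fin n) ℚ) p.1 p.2) Q : ℂ) := by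
    rw [hone]
    exact MvPolynomial.aeval_algebraMap_apply _ _ _
  simpa only [hP, hvalue, mul_comm] using
    hasDerivAt_aeval (fun p : Fin n × Fin n => hX p.1 p.2) P

theorem hodgeCircle_mem_hodgeGroup (z : Circle) : hodgeCircle V z ∈ A.hodgeGroup :=
  Subgroup.mem_sInf.2 fun _ hG => hG.2 z

theorem hodgeDeriv_mem_hodgeLie : hodgeDeriv V ∈ A.hodgeLie := fun F hF h0 => by
  obtain ⟨n, b, hb⟩ := A.exists_isLatticeBasis
  obtain ⟨q, hq⟩ := hb.exists_differential hF
  have hline := hq ℂ _ _ (by simp) (hasDerivAt_endMatrix_line b (hodgeDeriv V))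
  have hcircle := hq ℝ (fun s => hodgeCircle V (Circle.exp s)) (hodgeDeriv V) (by simp)
    fun i j => by simpa using hasDerivAt_endMatrix_hodgeCircle V b 0 i j
  simp only [h0 _ (hodgeCircle_mem_hodgeGroup _)] at hcircle
  exact hline.deriv.trans (hcircle.unique (hasDerivAt_const 0 0))

theorem IsLatticeBasis.exists_mem_hodgeLie_iff (hb : A.IsLatticeBasis b) :
    ∃ Q : Set (Fin n × Fin n → ℚ), ∀ X : Module.End ℂ (H1 V),
      X ∈ A.hodgeLie ↔ ∀ q ∈ Q, ∑ p, endMatrix b X p.1 p.2 * q p = 0 := by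
  refine ⟨{q | ∃ F ∈ A.ratPolynomials, (∀ g ∈ A.hodgeGroup, F g = 0) ∧
    ∀ X, lineDeriv ℂ F 1 X = ∑ p, endMatrix b X p.1 p.2 * q p}, fun X => ⟨?_, fun h F hF h0 => ?_⟩⟩
  · rintro hX q ⟨F, hF, h0, hq⟩
    rw [← hq, hX F hF h0]
  · obtain ⟨q, hq⟩ := hb.exists_differential hF
    have hline X : lineDeriv ℂ F 1 X = ∑ p, endMatrix b X p.1 p.2 * q p :=
      (hq ℂ _ _ (by simp) (hasDerivAt_endMatrix_line b X)).deriv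
    rw [hline, h q ⟨F, hF, h0, hline⟩]

/-- The Lie algebra of the Hodge group is defined over `ℚ`, because the differentials that cut it
out have rational coefficients. -/
theorem IsLatticeBasis.exists_span_eq_hodgeLie (hb : A.IsLatticeBasis b) :
    ∃ S : Set (Matrix (Fin n) (Fin n) ℚ),
      (Submodule.span ℂ ((·.map (algebraMap ℚ ℂ)) '' S) : Set (Matrix (Fin n) (Fin n) ℂ)) =
        endMatrix b '' A.hodgeLie := by
  obtain ⟨Q, hQ⟩ := hb.exists_mem_hodgeLie_iff
  let W : Submodule ℂ (Fin n × Fin n → ℂ) :=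
    ⨅ q ∈ Q, LinearMap.ker (Fintype.linearCombination ℂ fun p => (q p : ℂ))
  have mem_W x : x ∈ W ↔ ∀ q ∈ Q, ∑ p, x p * q p = 0 := by
    simp [W, Fintype.linearCombination_apply]
  have hW : ∀ w ∈ W, ∀ f : ℂ →ₗ[ℚ] ℂ, f ∘ w ∈ W := fun w hw f => (mem_W _).2 fun q hq => by
    have h := congrArg f ((mem_W w).1 hw q hq)
    have hf (z : ℂ) (r : ℚ) : f (z * r) = f z * r := by
      rw [mul_comm, ← Rat.smul_def, map_smul, Rat.smul_def, mul_comm]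
    simpa only [map_sum, hf, map_zero, Function.comp_apply] using h
  let curry : (Fin n × Fin n → ℂ) →ₗ[ℂ] Matrix (Fin n) (Fin n) ℂ :=
    (LinearEquiv.curry ℂ ℂ (Fin n) (Fin n)).toLinearMap
  refine ⟨(fun q => .of (Function.curry q)) '' (pointsOver ℚ W : Set _), ?_⟩
  have himage : (fun M : Matrix (Fin n) (Fin n) ℚ => M.map (algebraMap ℚ ℂ)) ''
      ((fun q => .of (Function.curry q)) '' (pointsOver ℚ W : Set _)) =
        curry '' ((algebraMap ℚ ℂ ∘ ·) '' (pointsOver ℚ W : Set _)) := by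
    rw [Set.image_image, Set.image_image]
    rfl
  rw [himage, Submodule.span_image, span_image_pointsOver hW]
  ext M
  constructor
  · rintro ⟨x, hx, rfl⟩
    refine ⟨(endMatrix b).symm (curry x), (hQ _).2 ?_, LinearEquiv.apply_symm_apply _ _⟩
    simp only [LinearEquiv.apply_symm_apply]
    exact (mem_W x).1 hx
  · rintro ⟨X, hX, rfl⟩
    exact ⟨fun p => endMatrix b X p.1 p.2, (mem_W _).2 ((hQ X).1 hX), rfl⟩

end ComplexAbelianVariety

/-! ## Hodge classes -/

namespace ComplexAbelianVariety

open CoordTensor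

section Invariance

variable {V : Type*} [NormedAddCommGroup V] [NormedSpace ℂ V] {n k : ℕ}
  (b : Module.Basis (Fin n) ℝ V)

theorem map_endMatrix_pullback (f : Module.End ℝ V) (ω : H V k) :
    map (endMatrix b (pullback f)) (alternatingCoord b k ω) =
      alternatingCoord b k (ω.compLinearMap f) := by
  ext m
  rw [alternatingCoord_apply, AlternatingMap.compLinearMap_apply, apply_eq_sum_alternatingCoord b,
    map_apply]
  refine Finset.sum_congr rfl fun l _ => ?_
  simp only [endMatrix_pullback, Complex.real_smul, Complex.ofReal_prod, Function.comp_apply]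

theorem mem_hodgeType_iff_forall_circle {p : ℕ} {ω : H V (p + p)} :
    ω ∈ hodgeType V p p ↔ ∀ (z : Circle) (v : Fin (p + p) → V),
      ω (fun i => (z : ℂ) • v i) = ω v := by
  have hnorm (z : ℂ) : z ^ p * (starRingEnd ℂ z) ^ p = (‖z‖ : ℂ) ^ (p + p) := by
    rw [← mul_pow, Complex.mul_conj, Complex.normSq_eq_norm_sq, ← two_mul, pow_mul]
    push_cast
    rfl
  refine ⟨fun h z v => ?_, fun h z v => ?_⟩
  · rw [h, hnorm, Circle.norm_coe, Complex.ofReal_one, one_pow, one_mul]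
  · have hz : (fun i => z • v i) = fun i => ‖z‖ • (Circle.exp z.arg : ℂ) • v i := funext fun i => by
      rw [← Complex.coe_smul, smul_smul, Circle.coe_exp, Complex.norm_mul_exp_arg_mul_I]
    have hsmul := ω.toMultilinearMap.map_smul_univ (fun _ => ‖z‖)
      fun i => (Circle.exp z.arg : ℂ) • v i
    rw [hz, hnorm, ← h (Circle.exp z.arg) v]
    simpa using hsmul

theorem mem_hodgeType_iff {p : ℕ} {ω : H V (p + p)} :
    ω ∈ hodgeType V p p ↔ ∀ z, map (endMatrix b (hodgeCircle V z)) (alternatingCoord b _ ω) =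
      alternatingCoord b _ ω := by
  simp only [mem_hodgeType_iff_forall_circle, hodgeCircle_eq_pullback, map_endMatrix_pullback,
    (alternatingCoord_injective b).eq_iff, AlternatingMap.ext_iff]
  rfl

theorem map_hodgeCircle_eq_of_deriv_eq_zero {t : CoordTensor ℂ (Fin n) k}
    (ht : deriv (endMatrix b (hodgeDeriv V)) t = 0) (z : Circle) :
    map (endMatrix b (hodgeCircle V z)) t = t := by
  obtain ⟨s, rfl⟩ := Circle.exp_surjective z
  ext m
  have hderiv (s : ℝ) := hasDerivAt_map (hasDerivAt_endMatrix_hodgeCircle V b s) t m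
  simp only [ht, map_zero, Pi.zero_apply] at hderiv
  have hconst := is_const_of_deriv_eq_zero (fun s => (hderiv s).differentiableAt)
    (fun s => (hderiv s).deriv) s 0
  simpa [endMatrix, LinearMap.toMatrix_one, CoordTensor.map_one] using hconst

/-- The subgroup of `GL(H¹(A, ℂ))` that fixes a tensor with given coordinates. -/
noncomputable def tensorStabilizer (t : CoordTensor ℂ (Fin n) k) :
    Subgroup (Module.End ℂ (H1 V))ˣ where
  carrier := {g | map (endMatrix b g) t = t}
  one_mem' := by
    rw [Set.mem_ofPred_eq, Units.val_one, endMatrix, LinearMap.toMatrix_one, CoordTensor.map_one]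
  mul_mem' {g h} hg hh := by
    rw [Set.mem_ofPred_eq, Units.val_mul, endMatrix, LinearMap.toMatrix_mul, ← map_map, hh, hg]
  inv_mem' {g} hg := by
    rw [Set.mem_ofPred_eq] at hg ⊢
    conv_lhs => rw [← hg]
    rw [map_map, endMatrix, ← LinearMap.toMatrix_mul, Units.inv_mul, LinearMap.toMatrix_one,
      CoordTensor.map_one]

theorem mem_tensorStabilizer {t : CoordTensor ℂ (Fin n) k} {g : (Module.End ℂ (H1 V))ˣ} :
    g ∈ tensorStabilizer b t ↔ map (endMatrix b g) t = t :=
  Iff.rfl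

end Invariance

variable {V : Type*} [NormedAddCommGroup V] [NormedSpace ℂ V] [FiniteDimensional ℂ V]
  {A : ComplexAbelianVariety V} {n k : ℕ} {b : Module.Basis (Fin n) ℝ V}

theorem hodgeGroup_le {G : Subgroup (Module.End ℂ (H1 V))ˣ} (hG : A.IsAlgebraicOverRat G)
    (hcircle : ∀ z, hodgeCircle V z ∈ G) : A.hodgeGroup ≤ G :=
  sInf_le ⟨hG, hcircle⟩

theorem IsLatticeBasis.endMatrix_mem_ratPolynomials (hb : A.IsLatticeBasis b) (i j : Fin n) :
    (fun X => endMatrix b X i j) ∈ A.ratPolynomials := by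
  rw [hb.ratPolynomials_eq_adjoin]
  exact Algebra.subset_adjoin ⟨(i, j), rfl⟩

theorem IsLatticeBasis.map_sub_mem_ratPolynomials (hb : A.IsLatticeBasis b)
    (q : CoordTensor ℚ (Fin n) k) (m : Fin k → Fin n) :
    (fun X => map (endMatrix b X) (algebraMap ℚ ℂ ∘ q) m - (algebraMap ℚ ℂ ∘ q) m) ∈
      A.ratPolynomials := by
  have hF : (fun X => map (endMatrix b X) (algebraMap ℚ ℂ ∘ q) m - (algebraMap ℚ ℂ ∘ q) m) =
      ∑ l, (∏ i, fun X => endMatrix b X (m i) (l i)) * algebraMap ℚ _ (q l) -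
        algebraMap ℚ _ (q m) := by
    funext X
    simp [map_apply]
  rw [hF]
  exact sub_mem (sum_mem fun l _ => mul_mem
    (prod_mem fun i _ => hb.endMatrix_mem_ratPolynomials _ _) (Subalgebra.algebraMap_mem _ _))
    (Subalgebra.algebraMap_mem _ _)

theorem IsLatticeBasis.isAlgebraicOverRat_tensorStabilizer (hb : A.IsLatticeBasis b)
    (q : CoordTensor ℚ (Fin n) k) :
    A.IsAlgebraicOverRat (tensorStabilizer b (algebraMap ℚ ℂ ∘ q)) :=
  ⟨_, Set.range_subset_iff.2 (hb.map_sub_mem_ratPolynomials q), fun g => by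
    simp only [mem_tensorStabilizer, Set.forall_mem_range, sub_eq_zero, funext_iff]⟩

theorem IsLatticeBasis.mem_invariants_hodgeLie_iff (hb : A.IsLatticeBasis b)
    (q : CoordTensor ℚ (Fin n) k) :
    algebraMap ℚ ℂ ∘ q ∈ invariants k (endMatrix b '' A.hodgeLie) ↔
      ∀ z, map (endMatrix b (hodgeCircle V z)) (algebraMap ℚ ℂ ∘ q) = algebraMap ℚ ℂ ∘ q := by
  refine ⟨fun h => map_hodgeCircle_eq_of_deriv_eq_zero b
    (mem_invariants.1 h _ ⟨_, hodgeDeriv_mem_hodgeLie, rfl⟩), fun h => mem_invariants.2 ?_⟩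
  rintro _ ⟨X, hX, rfl⟩
  have hfix := hodgeGroup_le (hb.isAlgebraicOverRat_tensorStabilizer q) h
  ext m
  have hline i j : HasDerivAt (fun s : ℂ => endMatrix b (1 + s • X) i j)
      ((endMatrix b (1 + (0 : ℂ) • X) * endMatrix b X) i j) 0 := by
    simpa [endMatrix, LinearMap.toMatrix_one] using hasDerivAt_endMatrix_line b X i j
  have hderiv := (hasDerivAt_map hline (algebraMap ℚ ℂ ∘ q) m).sub_const
    ((algebraMap ℚ ℂ ∘ q) m)
  have hzero := hX _ (hb.map_sub_mem_ratPolynomials q m) fun g hg => by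
    rw [hfix hg, sub_self]
  simpa [endMatrix, LinearMap.toMatrix_one, CoordTensor.map_one] using hderiv.deriv.symm.trans hzero

theorem IsLatticeBasis.mem_HRat_iff (hb : A.IsLatticeBasis b) {ω : H V k} :
    ω ∈ A.HRat k ↔ ∃ q : CoordTensor ℚ (Fin n) k, algebraMap ℚ ℂ ∘ q = alternatingCoord b k ω := by
  refine ⟨fun h => ?_, fun ⟨q, hq⟩ v hv => ?_⟩
  · choose q hq using fun m : Fin k → Fin n => h (b ∘ m) fun i => hb.mem (m i)
    exact ⟨q, funext fun m => (hq m).symm⟩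
  · choose N hN using fun i => hb.mem_iff.1 (hv i)
    refine ⟨∑ m : Fin k → Fin n, (∏ i, (N i (m i) : ℚ)) * q m, ?_⟩
    rw [apply_eq_sum_alternatingCoord b, ← hq]
    simp [hN]

theorem IsLatticeBasis.mem_hodgeClasses_iff (hb : A.IsLatticeBasis b) {p : ℕ}
    {ω : H V (p + p)} : ω ∈ A.hodgeClasses p ↔
      ∃ q ∈ pointsOver ℚ (alternating ℂ (Fin n) (p + p) ⊓
        invariants (p + p) (endMatrix b '' A.hodgeLie)),
        algebraMap ℚ ℂ ∘ q = alternatingCoord b (p + p) ω := by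
  rw [hodgeClasses, Submodule.mem_inf, hb.mem_HRat_iff, Submodule.restrictScalars_mem,
    mem_hodgeType_iff b]
  constructor
  · rintro ⟨⟨q, hq⟩, hz⟩
    rw [← hq] at hz
    refine ⟨q, mem_pointsOver.2 ⟨?_, (hb.mem_invariants_hodgeLie_iff q).2 hz⟩, hq⟩
    rw [hq]
    exact alternatingCoord_mem_alternating b ω
  · rintro ⟨q, hmem, hq⟩
    rw [← hq]
    exact ⟨⟨q, rfl⟩, (hb.mem_invariants_hodgeLie_iff q).1 hmem.2⟩

theorem IsLatticeBasis.comp_mem_invariants_hodgeLie (hb : A.IsLatticeBasis b)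
    {t : CoordTensor ℂ (Fin n) k} (ht : t ∈ invariants k (endMatrix b '' A.hodgeLie))
    (f : ℂ →ₗ[ℚ] ℂ) : f ∘ t ∈ invariants k (endMatrix b '' A.hodgeLie) := by
  obtain ⟨S, hS⟩ := hb.exists_span_eq_hodgeLie
  rw [← hS, invariants_span, mem_invariants, Set.forall_mem_image] at ht ⊢
  intro M hM
  ext m
  simpa [deriv_apply, ← Rat.smul_def] using congrArg f (congrFun (ht hM) m)

theorem IsLatticeBasis.finrank_hodgeClasses (hb : A.IsLatticeBasis b) (p : ℕ) :
    Module.finrank ℚ (A.hodgeClasses p) =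
      Module.finrank ℂ ↥(alternating ℂ (Fin n) (p + p) ⊓
        invariants (p + p) (endMatrix b '' A.hodgeLie)) := by
  refine finrank_eq_of_mem_iff_exists_pointsOver
    (f := (alternatingCoord (A := ℂ) b (p + p)).restrictScalars ℚ)
    (alternatingCoord_injective b) (fun t ht f => ⟨fun σ => ?_, ?_⟩) (fun t ht => ?_)
    fun ω => hb.mem_hodgeClasses_iff
  · exact funext fun m => (congrArg f (congrFun (ht.1 σ) m)).trans (map_zsmul f _ _)
  · exact hb.comp_mem_invariants_hodgeLie ht.2 f
  · rw [← range_alternatingCoord b] at ht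
    exact ht.1

end ComplexAbelianVariety

section PairBasis

open scoped Kronecker Matrix

variable {R ι M : Type*} [CommRing R] [Fintype ι] [AddCommGroup M] [Module R M]

/-- The basis of a module that corresponds to the standard basis of two copies of `ι → R`. -/
noncomputable def pairBasis (e : M ≃ₗ[R] (ι → R) × (ι → R)) : Module.Basis (Fin 2 × ι) R M :=
  .ofEquivFun (e ≪≫ₗ (LinearEquiv.finTwoArrow R (ι → R)).symm ≪≫ₗ
    (LinearEquiv.curry R R (Fin 2) ι).symm)

variable (e : M ≃ₗ[R] (ι → R) × (ι → R))

theorem pairBasis_repr (v : M) (p : Fin 2 × ι) :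
    (pairBasis e).repr v p = ![(e v).1, (e v).2] p.1 p.2 := by
  rw [pairBasis, Module.Basis.ofEquivFun_repr_apply]
  rfl

theorem toMatrix_pairBasis_eq_one_kronecker_iff [DecidableEq ι] {X : Module.End R M}
    {x : Matrix ι ι R} :
    LinearMap.toMatrix (pairBasis e) (pairBasis e) X = 1 ⊗ₖ x ↔
      ∀ v, e (X v) = (x *ᵥ (e v).1, x *ᵥ (e v).2) := by
  let Y := Matrix.toLin (pairBasis e) (pairBasis e) (1 ⊗ₖ x)
  have hY (v : M) : e (Y v) = (x *ᵥ (e v).1, x *ᵥ (e v).2) := by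
    have hblock (a : Fin 2) (i : ι) :
        ![(e (Y v)).1, (e (Y v)).2] a i = (x *ᵥ ![(e v).1, (e v).2] a) i := by
      rw [← pairBasis_repr e (Y v) (a, i), ← LinearMap.toMatrix_mulVec_repr (pairBasis e),
        LinearMap.toMatrix_toLin]
      simp [Matrix.mulVec, dotProduct, Fintype.sum_prod_type, Matrix.one_apply, pairBasis_repr]
    exact Prod.ext (funext (hblock 0)) (funext (hblock 1))
  rw [← LinearEquiv.eq_symm_apply, LinearMap.toMatrix_symm, LinearMap.ext_iff]
  exact forall_congr' fun v => by rw [← hY, e.injective.eq_iff]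

end PairBasis

namespace ComplexAbelianVariety

open CoordTensor
open scoped Kronecker

variable {V : Type*} [NormedAddCommGroup V] [NormedSpace ℂ V] [FiniteDimensional ℂ V]
  {A : ComplexAbelianVariety V}

theorem IsSo7Type.exists_basis (hA : A.IsSo7Type) :
    ∃ β : Module.Basis (Fin 2 × Finset (Fin 3)) ℂ (H1 V),
      LinearMap.toMatrix β β '' A.hodgeLie =
        (fun x => (1 : Matrix (Fin 2) (Fin 2) ℂ) ⊗ₖ x) '' Set.range Spin7.spinMatrix := by
  obtain ⟨-, e, he⟩ := hA
  refine ⟨pairBasis e, ?_⟩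
  have hLie (X : Module.End ℂ (H1 V)) : X ∈ A.hodgeLie ↔
      ∃ x, LinearMap.toMatrix (pairBasis e) (pairBasis e) X = 1 ⊗ₖ Spin7.spinMatrix x := by
    simp only [he, toMatrix_pairBasis_eq_one_kronecker_iff]
    rfl
  ext M
  constructor
  · rintro ⟨X, hX, rfl⟩
    obtain ⟨x, hx⟩ := (hLie X).1 hX
    exact ⟨_, ⟨x, rfl⟩, hx.symm⟩
  · rintro ⟨_, ⟨x, rfl⟩, rfl⟩
    exact ⟨Matrix.toLin (pairBasis e) (pairBasis e) (1 ⊗ₖ Spin7.spinMatrix x),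
      (hLie _).2 ⟨x, LinearMap.toMatrix_toLin _ _ _⟩, LinearMap.toMatrix_toLin _ _ _⟩

theorem IsSo7Type.finrank_hodgeClasses (hA : A.IsSo7Type) (p : ℕ) :
    Module.finrank ℚ (A.hodgeClasses p) = Module.finrank ℂ (Spin7.twoSpinForms (p + p)) := by
  obtain ⟨n, b, hb⟩ := A.exists_isLatticeBasis
  obtain ⟨β, hβ⟩ := hA.exists_basis
  rw [hb.finrank_hodgeClasses, finrank_alternating_inf_invariants_eq (h1Basis b) β, hβ,
    Spin7.twoSpinForms]

end ComplexAbelianVariety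

/-! ## Endomorphisms -/

section Centralizer

open scoped Kronecker

theorem finrank_centralizer_image {R A B : Type*} [CommSemiring R] [Semiring A] [Semiring B]
    [Algebra R A] [Algebra R B] (e : A ≃ₐ[R] B) (S : Set A) :
    Module.finrank R (Subalgebra.centralizer R (e '' S)) =
      Module.finrank R (Subalgebra.centralizer R S) := by
  have hmap : (Subalgebra.centralizer R S).map (e : A →ₐ[R] B) =
      Subalgebra.centralizer R (e '' S) := by
    ext y
    obtain ⟨z, rfl⟩ := e.surjective y
    simp [Subalgebra.mem_centralizer_iff, ← map_mul]
  rw [← hmap]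
  exact (((Subalgebra.centralizer R S).equivMapOfInjective (e : A →ₐ[R] B)
    e.injective).toLinearEquiv.finrank_eq).symm

variable {R ι κ : Type*} [CommRing R] [Fintype ι] [DecidableEq ι] [Fintype κ]

theorem one_kronecker_mul_eq_mul_one_kronecker_iff {x : Matrix κ κ R}
    {q : Matrix (ι × κ) (ι × κ) R} :
    (1 : Matrix ι ι R) ⊗ₖ x * q = q * (1 : Matrix ι ι R) ⊗ₖ x ↔ ∀ a c,
      x * q.submatrix (Prod.mk a) (Prod.mk c) = q.submatrix (Prod.mk a) (Prod.mk c) * x := by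
  simp only [← Matrix.ext_iff, Prod.forall, Matrix.mul_apply, Matrix.kronecker_apply,
    Fintype.sum_prod_type, Matrix.one_apply, Matrix.submatrix_apply]
  simp only [ite_mul, one_mul, zero_mul, mul_ite, mul_zero, Finset.sum_ite_irrel,
    Finset.sum_const_zero, Finset.sum_ite_eq, Finset.sum_ite_eq', Finset.mem_univ, if_true]
  exact forall_congr' fun a => forall_comm

theorem finrank_centralizer_one_kronecker [Nontrivial R] [DecidableEq κ] [Nonempty κ]
    {S : Set (Matrix κ κ R)}
    (hS : ∀ q, (∀ x ∈ S, x * q = q * x) → ∃ c : R, q = c • 1) :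
    Module.finrank R
        (Subalgebra.centralizer R ((fun x => (1 : Matrix ι ι R) ⊗ₖ x) '' S)) =
      Fintype.card ι * Fintype.card ι := by
  let f : Matrix ι ι R →ₗ[R] Matrix (ι × κ) (ι × κ) R :=
    (Matrix.kroneckerBilinear (R := R) (α := R)).flip (1 : Matrix κ κ R)
  have f_apply (c : Matrix ι ι R) : f c = c ⊗ₖ 1 := rfl
  have hf : Function.Injective f := fun c d h => by
    ext a a'
    obtain ⟨i⟩ := ‹Nonempty κ›
    simpa [f_apply] using congrFun (congrFun h (a, i)) (a', i)
  have hrange : LinearMap.range f = Subalgebra.toSubmodule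
      (Subalgebra.centralizer R ((fun x => (1 : Matrix ι ι R) ⊗ₖ x) '' S)) := by
    ext q
    simp only [Subalgebra.mem_toSubmodule, Subalgebra.mem_centralizer_iff, Set.forall_mem_image,
      LinearMap.mem_range]
    constructor
    · rintro ⟨c, rfl⟩ x -
      simp [f_apply, ← Matrix.mul_kronecker_mul]
    · intro hq
      choose c hc using fun a a' => hS (q.submatrix (Prod.mk a) (Prod.mk a')) fun x hx =>
        one_kronecker_mul_eq_mul_one_kronecker_iff.1 (hq hx) a a'
      refine ⟨.of c, ?_⟩
      ext ⟨a, i⟩ ⟨a', j⟩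
      exact (congrFun (congrFun (hc a a') i) j).symm
  calc _ = Module.finrank R (LinearMap.range f) := by rw [hrange]; rfl
    _ = _ := by rw [LinearMap.finrank_range_of_inj hf]; simp [Module.finrank_matrix]

end Centralizer

namespace ComplexAbelianVariety

variable {V : Type*} [NormedAddCommGroup V] [NormedSpace ℂ V] [FiniteDimensional ℂ V]
  {A : ComplexAbelianVariety V}

theorem IsSo7Type.finrank_centralizer_hodgeLie (hA : A.IsSo7Type) :
    Module.finrank ℂ (Subalgebra.centralizer ℂ A.hodgeLie) = 4 := by
  obtain ⟨β, hβ⟩ := hA.exists_basis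
  have himage : LinearMap.toMatrixAlgEquiv β '' A.hodgeLie = _ := hβ
  have hpauli {r} (hr : r ∈ Spin7.roots) : Spin7.pauli ℂ r ∈ Set.range Spin7.spinMatrix :=
    Spin7.range_spinMatrix.ge (Submodule.subset_span (Set.mem_image_of_mem _ hr))
  rw [← finrank_centralizer_image (LinearMap.toMatrixAlgEquiv β), himage,
    finrank_centralizer_one_kronecker fun q hq =>
      Spin7.exists_eq_smul_one_of_commute fun r hr => hq _ (hpauli hr), Fintype.card_fin]

variable (A) in
/-- The endomorphisms of the rational Hodge structure `H¹(A, ℚ)`, as endomorphisms of `H¹(A, ℂ)`: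
they preserve `H¹(A, ℚ)` and commute with the Lie algebra of the Hodge group. -/
noncomputable def rationalCommutant : Submodule ℚ (Module.End ℂ (H1 V)) where
  carrier := {Z | Z ∈ Subalgebra.centralizer ℂ A.hodgeLie ∧ ∀ ω ∈ A.H1Rat, Z ω ∈ A.H1Rat}
  zero_mem' := ⟨zero_mem _, fun _ _ => zero_mem _⟩
  add_mem' hZ hY := ⟨add_mem hZ.1 hY.1, fun ω hω => add_mem (hZ.2 ω hω) (hY.2 ω hω)⟩
  smul_mem' c _ hZ := ⟨Subalgebra.smul_mem _ hZ.1 (c : ℂ), fun ω hω =>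
    Submodule.smul_mem _ c (hZ.2 ω hω)⟩

variable {n : ℕ} {b : Module.Basis (Fin n) ℝ V}

theorem IsLatticeBasis.forall_mem_H1Rat_iff (hb : A.IsLatticeBasis b)
    {Z : Module.End ℂ (H1 V)} : (∀ ω ∈ A.H1Rat, Z ω ∈ A.H1Rat) ↔
      ∃ M : Matrix (Fin n) (Fin n) ℚ, M.map (algebraMap ℚ ℂ) = endMatrix b Z := by
  constructor
  · intro h
    choose M hM using fun i j => h _ (hb.h1Basis_mem j) _ (hb.mem i)
    exact ⟨.of M, by ext i j; rw [endMatrix_apply, hM]; rfl⟩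
  · rintro ⟨M, hM⟩ ω hω v hv
    choose r hr using fun j => hω _ (hb.mem j)
    choose N hN using hb.mem_iff.1 hv
    refine ⟨∑ i, ∑ j, N i * M i j * r j, ?_⟩
    rw [apply_eq_sum_endMatrix b, ← hM]
    simp [hr, hN]

theorem IsLatticeBasis.exists_mem_centralizer_hodgeLie_iff (hb : A.IsLatticeBasis b) :
    ∃ S : Set (Matrix (Fin n) (Fin n) ℚ), ∀ Z, Z ∈ Subalgebra.centralizer ℂ A.hodgeLie ↔
      ∀ M ∈ S, M.map (algebraMap ℚ ℂ) * endMatrix b Z =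
        endMatrix b Z * M.map (algebraMap ℚ ℂ) := by
  obtain ⟨S, hS⟩ := hb.exists_span_eq_hodgeLie
  refine ⟨S, fun Z => ?_⟩
  have hmem (M : Matrix (Fin n) (Fin n) ℂ) :
      M ∈ (Subalgebra.toSubmodule (Subalgebra.centralizer ℂ {endMatrix b Z}) : Set _) ↔
        M * endMatrix b Z = endMatrix b Z * M := by
    simp [Set.mem_centralizer_iff, eq_comm]
  calc Z ∈ Subalgebra.centralizer ℂ A.hodgeLie
      ↔ endMatrix b '' A.hodgeLie ⊆
          Subalgebra.toSubmodule (Subalgebra.centralizer ℂ {endMatrix b Z}) := by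
        simp only [Set.subset_def, Set.forall_mem_image, hmem, ← LinearMap.toMatrix_mul,
          EmbeddingLike.apply_eq_iff_eq, Subalgebra.mem_centralizer_iff]
    _ ↔ _ := by
        rw [← hS, SetLike.coe_subset_coe, Submodule.span_le]
        simp only [Set.subset_def, Set.forall_mem_image, hmem]

theorem IsLatticeBasis.endMatrix_symm_map_mem_centralizer (hb : A.IsLatticeBasis b)
    {Z : Module.End ℂ (H1 V)} (hZ : Z ∈ Subalgebra.centralizer ℂ A.hodgeLie) (φ : ℂ →ₗ[ℚ] ℂ) :
    (endMatrix b).symm ((endMatrix b Z).map φ) ∈ Subalgebra.centralizer ℂ A.hodgeLie := by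
  obtain ⟨S, hS⟩ := hb.exists_mem_centralizer_hodgeLie_iff
  have hφ (q : ℚ) (z : ℂ) : φ (q * z) = q * φ z := by
    rw [← Rat.smul_def, map_smul, Rat.smul_def]
  refine (hS _).2 fun M hM => ?_
  rw [LinearEquiv.apply_symm_apply]
  ext i j
  have h := congrArg φ (congrFun (congrFun ((hS Z).1 hZ M hM) i) j)
  simpa [Matrix.mul_apply, hφ, mul_comm _ (algebraMap ℚ ℂ _), mul_comm _ ((_ : ℚ) : ℂ)] using h

theorem finrank_rationalCommutant (A : ComplexAbelianVariety V) :
    Module.finrank ℚ A.rationalCommutant =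
      Module.finrank ℂ (Subalgebra.centralizer ℂ A.hodgeLie) := by
  obtain ⟨n, b, hb⟩ := A.exists_isLatticeBasis
  let f : Module.End ℂ (H1 V) ≃ₗ[ℂ] (Fin n × Fin n → ℂ) :=
    endMatrix b ≪≫ₗ (LinearEquiv.curry ℂ ℂ (Fin n) (Fin n)).symm
  let W := (Subalgebra.toSubmodule (Subalgebra.centralizer ℂ A.hodgeLie)).map
    f.toLinearMap
  have hW : ∀ w ∈ W, ∀ φ : ℂ →ₗ[ℚ] ℂ, φ ∘ w ∈ W := by
    rintro _ ⟨Z, hZ, rfl⟩ φ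
    exact ⟨_, hb.endMatrix_symm_map_mem_centralizer hZ φ, funext fun p =>
      congrFun (congrFun ((endMatrix b).apply_symm_apply _) p.1) p.2⟩
  rw [finrank_eq_of_mem_iff_exists_pointsOver (f := f.toLinearMap.restrictScalars ℚ)
    f.injective hW (Set.image_subset_range _ _) fun Z => ?_]
  · exact (f.submoduleMap (Subalgebra.toSubmodule
      (Subalgebra.centralizer ℂ A.hodgeLie))).finrank_eq.symm
  change Z ∈ Subalgebra.centralizer ℂ A.hodgeLie ∧ _ ↔ _
  rw [hb.forall_mem_H1Rat_iff]
  constructor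
  · rintro ⟨hZ, M, hM⟩
    have hqZ : algebraMap ℚ ℂ ∘ (fun p => M p.1 p.2) = f Z :=
      funext fun p => congrFun (congrFun hM p.1) p.2
    exact ⟨_, mem_pointsOver.2 (hqZ ▸ ⟨Z, hZ, rfl⟩), hqZ⟩
  · rintro ⟨q, hq, hqZ⟩
    rw [mem_pointsOver, hqZ] at hq
    obtain ⟨Y, hY, hYZ⟩ := hq
    exact ⟨f.injective hYZ ▸ hY, .of (Function.curry q), by
      ext i j; exact congrFun hqZ (i, j)⟩

end ComplexAbelianVariety

section LinearLift

variable {𝕜 E F : Type*} [RCLike 𝕜] [NormedAddCommGroup E] [NormedSpace 𝕜 E]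
  [NormedAddCommGroup F] [NormedSpace 𝕜 F]

theorem tendsto_two_pow_inv_smul (v : E) :
    Filter.Tendsto (fun N : ℕ => ((2 : 𝕜) ^ N)⁻¹ • v) Filter.atTop (𝓝 0) := by
  have h : Filter.Tendsto (fun N : ℕ => ((2 : 𝕜)⁻¹ ^ N)) Filter.atTop (𝓝 0) :=
    tendsto_pow_atTop_nhds_zero_of_norm_lt_one (by rw [norm_inv, RCLike.norm_two]; norm_num)
  simpa only [inv_pow, zero_smul] using h.smul_const v

theorem norm_two_pow_inv_smul_le (N : ℕ) (v : E) : ‖((2 : 𝕜) ^ N)⁻¹ • v‖ ≤ ‖v‖ := by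
  rw [norm_smul, norm_inv, norm_pow, RCLike.norm_two]
  exact mul_le_of_le_one_left (norm_nonneg v)
    (inv_le_one_of_one_le₀ (one_le_pow₀ one_le_two))

/-- Iterating the functional equation writes `f w` as the difference quotient
`2 ^ N • f (2⁻ᴺ • w)`, which converges to the derivative. -/
theorem eventually_eq_fderiv_of_eq_two_smul {f : E → F} {T : E →L[𝕜] F} (hf : HasFDerivAt f T 0)
    (h2 : ∀ᶠ w in 𝓝 0, f w = (2 : 𝕜) • f ((2 : 𝕜)⁻¹ • w)) : ∀ᶠ w in 𝓝 0, f w = T w := by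
  have h0 : f 0 = 0 := by
    have h := h2.self_of_nhds
    rwa [smul_zero, two_smul, left_eq_add] at h
  obtain ⟨r, hr, hball⟩ := Metric.eventually_nhds_iff.1 h2
  simp only [dist_zero_right] at hball
  refine Metric.eventually_nhds_iff.2 ⟨r, hr, fun w hw => ?_⟩
  rw [dist_zero_right] at hw
  have hiter (N : ℕ) : (2 : 𝕜) ^ N • f (((2 : 𝕜) ^ N)⁻¹ • w) = f w := by
    induction N with
    | zero => simp
    | succ N ih =>
      rw [← ih, hball ((norm_two_pow_inv_smul_le N w).trans_lt hw), smul_smul, smul_smul,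
        ← pow_succ, ← mul_inv, ← pow_succ']
  have hlim := hf.lim w (c := fun N : ℕ => (2 : 𝕜) ^ N) (l := Filter.atTop) (by
    simp only [norm_pow, RCLike.norm_two]
    exact tendsto_pow_atTop_atTop_of_one_lt one_lt_two)
  simp only [zero_add, h0, sub_zero, hiter] at hlim
  exact tendsto_nhds_unique tendsto_const_nhds hlim

variable {Q : Type*} [AddCommGroup Q] {π : F →+ Q} {φ : E →+ Q}

theorem eventually_eq_two_smul_of_lift (hπ : ∀ᶠ w in 𝓝 0, π w = 0 → w = 0) {f : E → F}
    (hf : ContinuousAt f 0) (h0 : f 0 = 0) (hlift : ∀ᶠ w in 𝓝 0, π (f w) = φ w) :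
    ∀ᶠ w in 𝓝 0, f w = (2 : 𝕜) • f ((2 : 𝕜)⁻¹ • w) := by
  have hhalf : Filter.Tendsto (fun w : E => (2 : 𝕜)⁻¹ • w) (𝓝 0) (𝓝 0) := by
    simpa using (continuous_const_smul (2 : 𝕜)⁻¹).tendsto (0 : E)
  have hf' : Filter.Tendsto f (𝓝 0) (𝓝 0) := by simpa [ContinuousAt, h0] using hf
  have hsub : Filter.Tendsto (fun w => f w - (2 : 𝕜) • f ((2 : 𝕜)⁻¹ • w)) (𝓝 0) (𝓝 0) := by
    simpa using hf'.sub ((hf'.comp hhalf).const_smul (2 : 𝕜))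
  filter_upwards [hsub.eventually hπ, hlift, hhalf.eventually hlift] with w hw h1 h2
  refine sub_eq_zero.1 (hw ?_)
  rw [map_sub, two_smul, map_add, h1, h2, ← map_add, ← two_smul 𝕜, smul_inv_smul₀ two_ne_zero,
    sub_self]

theorem addMonoidHom_eq_of_eventually_eq (𝕜 : Type*) [RCLike 𝕜] [NormedSpace 𝕜 E] {G : Type*}
    [FunLike G E Q] [AddMonoidHomClass G E Q] {φ ψ : G} (h : ∀ᶠ w in 𝓝 0, φ w = ψ w) : φ = ψ := by
  refine DFunLike.ext _ _ fun v => ?_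
  obtain ⟨N, hN⟩ := ((tendsto_two_pow_inv_smul (𝕜 := 𝕜) v).eventually h).exists
  have hv : v = 2 ^ N • (((2 : 𝕜) ^ N)⁻¹ • v) := by
    rw [← Nat.cast_smul_eq_nsmul 𝕜, Nat.cast_pow, Nat.cast_ofNat,
      smul_inv_smul₀ (pow_ne_zero N two_ne_zero)]
  rw [hv, map_nsmul, map_nsmul, hN]

theorem exists_linear_lift (hπ : ∀ᶠ w in 𝓝 0, π w = 0 → w = 0) {f : E → F}
    (hf : DifferentiableAt 𝕜 f 0) (hlift : ∀ᶠ w in 𝓝 0, π (f w) = φ w) :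
    ∃ T : E →L[𝕜] F, ∀ v, π (T v) = φ v := by
  have hπ0 : π (f 0) = 0 := by rw [hlift.self_of_nhds, map_zero]
  have hlift' : ∀ᶠ w in 𝓝 0, π (f w - f 0) = φ w := by
    simpa only [map_sub, hπ0, sub_zero] using hlift
  have hderiv := hf.hasFDerivAt.sub_const (f 0)
  have hlin := eventually_eq_fderiv_of_eq_two_smul hderiv
    (eventually_eq_two_smul_of_lift hπ hderiv.continuousAt (sub_self _) hlift')
  refine ⟨_, DFunLike.congr_fun (addMonoidHom_eq_of_eventually_eq 𝕜
    (φ := π.comp ((fderiv 𝕜 f 0 : E →ₗ[𝕜] F) : E →+ F)) ?_)⟩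
  filter_upwards [hlin, hlift'] with w hw h
  rw [← h, hw]
  rfl

theorem eq_of_forall_map_eq (hπ : ∀ᶠ w in 𝓝 0, π w = 0 → w = 0) {S T : E →L[𝕜] F}
    (h : ∀ v, π (S v) = π (T v)) : S = T := by
  have hlim : Filter.Tendsto (S - T) (𝓝 0) (𝓝 0) := (S - T).continuous.tendsto' 0 0 (map_zero _)
  refine addMonoidHom_eq_of_eventually_eq 𝕜 ?_
  filter_upwards [hlim.eventually hπ] with w hw
  refine sub_eq_zero.1 (hw ?_)
  rw [sub_apply, map_sub, h, sub_self]

end LinearLift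

theorem finrank_rat_tensor_eq {M W : Type*} [AddCommGroup M] [AddCommGroup W] [Module ℚ W]
    {f : M →ₗ[ℤ] W} (hinj : Function.Injective f)
    (hsurj : ∀ w, ∃ (N : nonZeroDivisors ℤ) (x : M), f x = (N : ℤ) • w) :
    Module.finrank ℚ (ℚ ⊗[ℤ] M) = Module.finrank ℚ W := by
  have : IsLocalizedModule (nonZeroDivisors ℤ) f :=
    { map_units := fun N => by
        have hN : ((N : ℤ) : ℚ) ≠ 0 := Int.cast_ne_zero.2 (nonZeroDivisors.coe_ne_zero N)
        simpa using hN.isUnit.map (Module.toModuleEnd ℤ (S := ℚ) W)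
      surj := fun w => by
        obtain ⟨N, x, h⟩ := hsurj w
        exact ⟨(x, N), h.symm⟩
      exists_of_eq := fun h => ⟨1, by rw [hinj h]⟩ }
  exact (IsLocalizedModule.isBaseChange (nonZeroDivisors ℤ) ℚ f).equiv.finrank_eq

namespace ComplexAbelianVariety

variable {V : Type*} [NormedAddCommGroup V] [NormedSpace ℂ V]

section Pullback

variable {n : ℕ} (b : Module.Basis (Fin n) ℝ V)

theorem pullback_mul (f g : Module.End ℝ V) : pullback (f * g) = pullback g * pullback f :=
  rfl

include b in
theorem pullback_injective : Function.Injective (pullback (V := V)) := fun f g h =>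
  b.ext fun i => b.ext_elem fun j => by
    have hij := endMatrix_pullback b f i j
    rw [h, endMatrix_pullback] at hij
    exact_mod_cast hij.symm

theorem exists_pullback_eq {Z : Module.End ℂ (H1 V)} {M : Matrix (Fin n) (Fin n) ℝ}
    (hM : M.map (algebraMap ℝ ℂ) = endMatrix b Z) : ∃ f : Module.End ℝ V, pullback f = Z := by
  refine ⟨Matrix.toLin b b M.transpose, (endMatrix b).injective ?_⟩
  ext i j
  rw [endMatrix_pullback, ← hM, ← LinearMap.toMatrix_apply, LinearMap.toMatrix_toLin]
  rfl

theorem exists_complexLinear_of_commute_I {f : Module.End ℝ V}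
    (hf : ∀ v, f (Complex.I • v) = Complex.I • f v) :
    ∃ T : V →ₗ[ℂ] V, T.restrictScalars ℝ = f :=
  ⟨{ f with
      map_smul' c v := by
        change f (c • v) = c • f v
        rw [← Complex.re_add_im c, add_smul, add_smul, map_add, mul_smul, mul_smul]
        simp only [Complex.coe_smul, map_smul, hf] }, rfl⟩

end Pullback

/-- The elements of the group of units of a monoid that commute with a given element. -/
def unitCentralizer {M : Type*} [Monoid M] (z : M) : Subgroup Mˣ where
  carrier := {g | Commute (g : M) z}
  one_mem' := Commute.one_left z
  mul_mem' := Commute.mul_left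
  inv_mem' := Commute.units_inv_left

variable [FiniteDimensional ℂ V] {A : ComplexAbelianVariety V}

section Commutant

variable {n : ℕ} {b : Module.Basis (Fin n) ℝ V}

theorem IsLatticeBasis.commutator_mem_ratPolynomials (hb : A.IsLatticeBasis b)
    {Z : Module.End ℂ (H1 V)} (hZ : ∀ ω ∈ A.H1Rat, Z ω ∈ A.H1Rat) (i j : Fin n) :
    (fun X => endMatrix b (X * Z - Z * X) i j) ∈ A.ratPolynomials := by
  obtain ⟨M, hM⟩ := hb.forall_mem_H1Rat_iff.1 hZ
  have hF : (fun X => endMatrix b (X * Z - Z * X) i j) =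
      ∑ l, ((fun X => endMatrix b X i l) * algebraMap ℚ _ (M l j) -
        algebraMap ℚ _ (M i l) * fun X => endMatrix b X l j) := by
    funext X
    rw [map_sub, endMatrix, LinearMap.toMatrix_mul, LinearMap.toMatrix_mul, ← endMatrix, ← hM]
    simp [Matrix.mul_apply, Finset.sum_apply]
  rw [hF]
  exact sum_mem fun l _ => sub_mem
    (mul_mem (hb.endMatrix_mem_ratPolynomials i l) (Subalgebra.algebraMap_mem _ _))
    (mul_mem (Subalgebra.algebraMap_mem _ _) (hb.endMatrix_mem_ratPolynomials l j))

theorem mem_centralizer_hodgeLie_of_commute_hodgeCircle {Z : Module.End ℂ (H1 V)}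
    (hrat : ∀ ω ∈ A.H1Rat, Z ω ∈ A.H1Rat)
    (hZ : ∀ z, Commute (hodgeCircle V z : Module.End ℂ (H1 V)) Z) :
    Z ∈ Subalgebra.centralizer ℂ A.hodgeLie := by
  obtain ⟨n, b, hb⟩ := A.exists_isLatticeBasis
  have hF := hb.commutator_mem_ratPolynomials hrat
  have hcomm (X : Module.End ℂ (H1 V)) :
      Commute X Z ↔ ∀ i j, endMatrix b (X * Z - Z * X) i j = 0 := by
    rw [commute_iff_eq, ← sub_eq_zero, ← (endMatrix b).map_eq_zero_iff, ← Matrix.ext_iff]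
    rfl
  have hle : A.hodgeGroup ≤ unitCentralizer Z :=
    hodgeGroup_le ⟨_, Set.range_subset_iff.2 fun p : Fin n × Fin n => hF p.1 p.2, fun g =>
      (hcomm g).trans (by simp only [Set.forall_mem_range, Prod.forall])⟩ hZ
  rw [Subalgebra.mem_centralizer_iff]
  refine fun X hX => (hcomm X).2 fun i j => ?_
  have hderiv := hX _ (hF i j) fun g hg => (hcomm g).1 (hle hg) i j
  have hlin (t : ℂ) : endMatrix b ((1 + t • X) * Z - Z * (1 + t • X)) i j =
      t * endMatrix b (X * Z - Z * X) i j := by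
    rw [add_mul, mul_add, one_mul, mul_one, add_sub_add_left_eq_sub, smul_mul_assoc,
      mul_smul_comm, ← smul_sub (A := Module.End ℂ (H1 V)), map_smul, Matrix.smul_apply,
      smul_eq_mul]
  simpa only [lineDeriv, hlin, deriv_mul_const_field', deriv_id'', one_mul] using hderiv

theorem exists_pullback_eq_of_mem_rationalCommutant {Z : Module.End ℂ (H1 V)}
    (hZ : Z ∈ A.rationalCommutant) : ∃ T : V →ₗ[ℂ] V, pullback (T.restrictScalars ℝ) = Z := by
  obtain ⟨n, b, hb⟩ := A.exists_isLatticeBasis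
  obtain ⟨M, hM⟩ := hb.forall_mem_H1Rat_iff.1 hZ.2
  obtain ⟨f, rfl⟩ := exists_pullback_eq b (M := M.map (algebraMap ℚ ℝ)) (Z := Z) (by
    rw [← hM]; ext; simp)
  have hf : pullback (f * DistribSMul.toLinearMap ℝ V Complex.I) =
      pullback (DistribSMul.toLinearMap ℝ V Complex.I * f) :=
    Subalgebra.mem_centralizer_iff ℂ |>.1 hZ.1 _ hodgeDeriv_mem_hodgeLie
  obtain ⟨T, rfl⟩ := exists_complexLinear_of_commute_I
    (LinearMap.congr_fun (pullback_injective b hf))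
  exact ⟨T, rfl⟩

end Commutant

section EndRing

variable (A) in
/-- The complex-linear endomorphisms of `V` that preserve the lattice, which is the analytic
description of `End(A)`. -/
def latticeEnd : Submodule ℤ (V →ₗ[ℂ] V) where
  carrier := {T | ∀ v ∈ A.lattice, T v ∈ A.lattice}
  zero_mem' _ _ := zero_mem _
  add_mem' hS hT v hv := add_mem (hS v hv) (hT v hv)
  smul_mem' c _ hT v hv := A.lattice.smul_mem c (hT v hv)

theorem eventually_eq_zero_of_mkQ_eq_zero (A : ComplexAbelianVariety V) :
    ∀ᶠ v in 𝓝 0, A.lattice.mkQ v = 0 → v = 0 := by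
  obtain ⟨U, hU, hU0⟩ := discreteTopology_subtype_iff'.1 A.discrete 0 (zero_mem A.lattice)
  have h0 : (0 : V) ∈ U ∩ A.lattice := hU0 ▸ rfl
  filter_upwards [hU.mem_nhds h0.1] with v hv hker
  exact hU0.subset ⟨hv, by rwa [← Submodule.ker_mkQ A.lattice]⟩

variable (A) in
/-- The homomorphism `φ` of `A` induced by a linear endomorphism of `V` that preserves `Λ`. -/
def latticeEndToEndRing : A.latticeEnd →+ A.endRing where
  toFun T := ⟨(A.lattice.mapQ A.lattice (T.1.restrictScalars ℤ) T.2).toAddMonoidHom, fun _ =>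
    ⟨T, .of_forall fun _ => ⟨(LinearMap.toContinuousLinearMap T.1).differentiableAt, rfl⟩⟩⟩
  map_zero' := Subtype.ext (AddMonoidHom.ext fun x => by
    obtain ⟨v, rfl⟩ := A.lattice.mkQ_surjective x
    exact map_zero A.lattice.mkQ)
  map_add' S T := Subtype.ext (AddMonoidHom.ext fun x => by
    obtain ⟨v, rfl⟩ := A.lattice.mkQ_surjective x
    exact map_add A.lattice.mkQ _ _)

theorem latticeEndToEndRing_bijective : Function.Bijective A.latticeEndToEndRing := by
  constructor
  · intro S T h
    have hST := eq_of_forall_map_eq (π := A.lattice.mkQ.toAddMonoidHom)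
      A.eventually_eq_zero_of_mkQ_eq_zero (S := LinearMap.toContinuousLinearMap S.1)
      (T := LinearMap.toContinuousLinearMap T.1)
      fun v => DFunLike.congr_fun (congrArg Subtype.val h) (A.lattice.mkQ v)
    exact Subtype.ext (LinearMap.toContinuousLinearMap.injective hST)
  · intro φ
    obtain ⟨f, hf⟩ := φ.2 0
    obtain ⟨T, hT⟩ := exists_linear_lift (π := A.lattice.mkQ.toAddMonoidHom)
      (φ := φ.1.comp A.lattice.mkQ.toAddMonoidHom) A.eventually_eq_zero_of_mkQ_eq_zero
      hf.self_of_nhds.1 (hf.mono fun _ h => h.2)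
    have hlattice : ∀ v ∈ A.lattice, T v ∈ A.lattice := fun v hv => by
      rw [← A.lattice.ker_mkQ, LinearMap.mem_ker] at hv ⊢
      exact (hT v).trans ((congrArg φ.1 hv).trans (map_zero φ.1))
    refine ⟨⟨T, hlattice⟩, Subtype.ext (AddMonoidHom.ext fun x => ?_)⟩
    obtain ⟨v, rfl⟩ := A.lattice.mkQ_surjective x
    exact hT v

theorem pullback_mem_rationalCommutant {T : V →ₗ[ℂ] V} (hT : T ∈ A.latticeEnd) :
    pullback (T.restrictScalars ℝ) ∈ A.rationalCommutant := by
  have hrat : ∀ ω ∈ A.H1Rat, pullback (T.restrictScalars ℝ) ω ∈ A.H1Rat :=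
    fun ω hω v hv => hω _ (hT v hv)
  refine ⟨mem_centralizer_hodgeLie_of_commute_hodgeCircle hrat fun z => ?_, hrat⟩
  rw [hodgeCircle_eq_pullback, commute_iff_eq, ← pullback_mul, ← pullback_mul]
  congr 1
  ext v
  exact T.map_smul z v

variable (A) in
/-- The action of `End(A)` on `H¹(A, ℚ)`. -/
noncomputable def latticeEndPullback : A.latticeEnd →ₗ[ℤ] A.rationalCommutant :=
  AddMonoidHom.toIntLinearMap (M := A.latticeEnd) (M₂ := A.rationalCommutant)
    { toFun := fun T => ⟨pullback (T.1.restrictScalars ℝ), pullback_mem_rationalCommutant T.2⟩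
      map_zero' := Subtype.ext (LinearMap.ext fun ω => LinearMap.ext fun _ => map_zero ω)
      map_add' := fun _ _ => Subtype.ext (LinearMap.ext fun ω => LinearMap.ext fun _ =>
        map_add ω _ _) }

theorem latticeEndPullback_injective : Function.Injective A.latticeEndPullback := fun S T h => by
  obtain ⟨n, b, -⟩ := A.exists_isLatticeBasis
  exact Subtype.ext (LinearMap.restrictScalars_injective ℝ
    (pullback_injective b (congrArg Subtype.val h)))

theorem exists_zsmul_mem_latticeEnd {T : V →ₗ[ℂ] V}
    (hT : pullback (T.restrictScalars ℝ) ∈ A.rationalCommutant) :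
    ∃ N : nonZeroDivisors ℤ, N • T ∈ A.latticeEnd := by
  obtain ⟨n, b, hb⟩ := A.exists_isLatticeBasis
  obtain ⟨M, hM⟩ := hb.forall_mem_H1Rat_iff.1 hT.2
  obtain ⟨N, hN⟩ := IsLocalization.exist_integer_multiples_of_finite (nonZeroDivisors ℤ)
    fun p : Fin n × Fin n => M p.1 p.2
  have hbasis (i : Fin n) : (N • T) (b i) ∈ A.lattice := hb.mem_iff.2 fun j => by
    obtain ⟨m, hm⟩ := hN (i, j)
    have hij : (b.repr (T (b i)) j : ℂ) = M i j := by
      rw [← LinearMap.restrictScalars_apply ℝ T, ← endMatrix_pullback, ← hM]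
      rfl
    refine ⟨m, ?_⟩
    have hm' : (m : ℂ) = (N : ℤ) * M i j := by
      simpa using congrArg (algebraMap ℚ ℂ) hm
    rw [← hij] at hm'
    change b.repr ((N : ℤ) • T (b i)) j = m
    rw [map_zsmul, Finsupp.smul_apply, zsmul_eq_mul]
    exact_mod_cast hm'.symm
  refine ⟨N, fun v hv => ?_⟩
  rw [← hb] at hv
  exact (Submodule.map_span_le ((N • T).restrictScalars ℤ) _ _).2
    (Set.forall_mem_range.2 hbasis) ⟨v, hv, rfl⟩

theorem exists_zsmul_eq_latticeEndPullback (Z : A.rationalCommutant) :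
    ∃ (N : nonZeroDivisors ℤ) (T : A.latticeEnd), A.latticeEndPullback T = (N : ℤ) • Z := by
  obtain ⟨T, hT⟩ := exists_pullback_eq_of_mem_rationalCommutant Z.2
  obtain ⟨N, hN⟩ := exists_zsmul_mem_latticeEnd (hT ▸ Z.2)
  refine ⟨N, ⟨_, hN⟩, Subtype.ext (LinearMap.ext fun ω => LinearMap.ext fun v => ?_)⟩
  have hZ : Z.1 ω v = ω (T v) := by rw [← hT]; rfl
  change ω ((N : ℤ) • T v) = (N : ℤ) • Z.1 ω v
  rw [map_zsmul, hZ]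

theorem finrank_endRing (A : ComplexAbelianVariety V) : Module.finrank ℚ (ℚ ⊗[ℤ] A.endRing) =
    Module.finrank ℂ (Subalgebra.centralizer ℂ A.hodgeLie) := by
  have e : A.latticeEnd ≃ₗ[ℤ] A.endRing :=
    (AddEquiv.ofBijective _ A.latticeEndToEndRing_bijective).toIntLinearEquiv
  rw [← finrank_rationalCommutant, ← (e.baseChange ℤ ℚ _ _).finrank_eq]
  exact finrank_rat_tensor_eq A.latticeEndPullback_injective A.exists_zsmul_eq_latticeEndPullback

end EndRing

end ComplexAbelianVariety

theorem corollary6p5 {V : Type*} [NormedAddCommGroup V] [NormedSpace ℂ V]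
    [FiniteDimensional ℂ V] (A : ComplexAbelianVariety V) (hA : A.IsSo7Type) :
    Module.finrank ℚ (A.hodgeClasses 1) = 1 ∧
    Module.finrank ℚ (A.hodgeClasses 2) = 6 ∧
    Module.finrank ℚ (ℚ ⊗[ℤ] A.endRing) = 4 :=
  ⟨(hA.finrank_hodgeClasses 1).trans Spin7.finrank_twoSpinForms_two,
    (hA.finrank_hodgeClasses 2).trans Spin7.finrank_twoSpinForms_four,
    A.finrank_endRing.trans hA.finrank_centralizer_hodgeLie⟩
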